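/- Let $\theta_m>0$. For $x\ge 0$ let $p_x$ and $q_x$ be the probability measures on $[0,\infty)$ with densities $$p_x(y)=\frac{1}{1+\theta_m^2x}\exp\Bigl(-\frac{y}{1+\theta_m^2x}\Bigr),\qquad q_x(z)=\frac{1}{1+x}\exp\Bigl(-\frac{z}{1+x}\Bigr),$$ and let $w_{Y|X}\colon x\mapsto p_x$ and $w_{Z|X}\colon x\mapsto q_x$ be the corresponding channels (the main channel and the warden's channel of the normalized non-coherent Rayleigh-fading model). For a Borel probability measure $\mu$ on $[0,\infty)$ write $w\circ\mu$ for the output law of the channel $w$ with input law $\mu$, $I(\mu,w)$ for the mutual information between input and output, and $\mathbb{D}(\cdot\|\cdot)$ for relative entropy. For $\nu>0$ consider the problem $$A(\nu)=\sup\bigl\{\,I(\mu,w_{Y|X})\;:\;\mu\text{ a probability measure on }[0,\infty),\ \mathbb{D}(w_{Z|X}\circ\mu\,\|\,q_0)\le\nu\,\bigr\}.$$ There exists $\nu_0>0$ (depending on $\theta_m$) such that for every $0<\nu<\nu_0$ there is exactly one feasible $\mu$ attaining $A(\nu)$, denoted $\mu^*_\nu$, and the support of $\mu^*_\nu$ is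 a finite set (so $\mu^*_\nu$ has finitely many mass points). -/

import Mathlib

open MeasureTheory ProbabilityTheory InformationTheory Set
open scoped NNReal ENNReal ProbabilityTheory

/-- The transition density `y ↦ (1 + θ² x)⁻¹ exp (-y / (1 + θ² x))`, `y ≥ 0`, of the (normalised)
non-coherent Rayleigh-fading channel with fading variance `θ²` and input `x ≥ 0`. -/
noncomputable def rayleighPDF (θ : ℝ) (x : ℝ≥0) (y : ℝ) : ℝ :=
  1 / (θ ^ 2 * x + 1) * Real.exp (-(y / (θ ^ 2 * x + 1)))

theorem measurable_rayleighPDF (θ : ℝ) :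
    Measurable (fun p : ℝ≥0 × ℝ => ENNReal.ofReal (rayleighPDF θ p.1 p.2)) := by
  unfold rayleighPDF
  fun_prop

/-- The channel `x ↦ p_x` from inputs in `[0, ∞)`: the output law has density `rayleighPDF θ x`
with respect to Lebesgue measure on `[0, ∞)`. -/
noncomputable def rayleighChannel (θ : ℝ) : Kernel ℝ≥0 ℝ where
  toFun x := (volume.restrict (Ici (0 : ℝ))).withDensity
    (fun y => ENNReal.ofReal (rayleighPDF θ x y))
  measurable' := by
    refine Measure.measurable_of_measurable_coe _ fun s hs => ?_
    simp only [withDensity_apply _ hs]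
    exact (measurable_rayleighPDF θ).lintegral_prod_right'

instance isMarkovKernel_rayleighChannel (θ : ℝ) : IsMarkovKernel (rayleighChannel θ) := by
  refine ⟨fun x => ⟨?_⟩⟩
  have hc : 0 < 1 / (θ ^ 2 * (x : ℝ) + 1) := by positivity
  change (volume.restrict (Ici (0 : ℝ))).withDensity
    (fun y => ENNReal.ofReal (rayleighPDF θ x y)) univ = 1
  rw [withDensity_apply _ MeasurableSet.univ, Measure.restrict_univ,
    ← lintegral_exponentialPDF_eq_one hc, ← lintegral_indicator measurableSet_Ici]
  refine lintegral_congr fun y => ?_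
  by_cases hy : 0 ≤ y
  · rw [indicator_of_mem (mem_Ici.2 hy), exponentialPDF_eq, if_pos hy, rayleighPDF]
    congr 3
    ring
  · rw [indicator_of_notMem (by simpa using hy), exponentialPDF_eq, if_neg hy]
    simp

/-- The main channel `w_{Y|X}`, with parameter `θ_m`. -/
noncomputable abbrev mainChannel (θm : ℝ) : Kernel ℝ≥0 ℝ := rayleighChannel θm

/-- The warden's channel `w_{Z|X}`, normalised to fading variance `1`. -/
noncomputable abbrev wardenChannel : Kernel ℝ≥0 ℝ := rayleighChannel 1

/-- The mutual information `I(μ, w) = D(μ × w ‖ μ ⊗ (w ∘ μ))` between the input and the output of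
the channel `w` with input law `μ`. -/
noncomputable def mutualInfo (μ : ProbabilityMeasure ℝ≥0) (w : Kernel ℝ≥0 ℝ) : ℝ≥0∞ :=
  klDiv ((μ : Measure ℝ≥0) ⊗ₘ w) ((μ : Measure ℝ≥0).prod (w ∘ₘ (μ : Measure ℝ≥0)))

/-- The relative entropy `D(w_{Z|X} ∘ μ ‖ q_0)` between the warden's output law induced by `μ`
and the warden's output law `q_0` induced by the input `0`. -/
noncomputable def wardenDivergence (μ : ProbabilityMeasure ℝ≥0) : ℝ≥0∞ :=
  klDiv (wardenChannel ∘ₘ (μ : Measure ℝ≥0)) (wardenChannel 0)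

/-- The input laws satisfying the covertness constraint `D(w_{Z|X} ∘ μ ‖ q_0) ≤ ν`; for such laws
the relative entropy is in particular finite. -/
def covertInputs (ν : ℝ) : Set (ProbabilityMeasure ℝ≥0) :=
  {μ | wardenDivergence μ ≤ ENNReal.ofReal ν}

/-- The optimal value `A(ν)`: the supremum of `I(μ, w_{Y|X})` under the covertness constraint. -/
noncomputable def covertValue (θm ν : ℝ) : ℝ≥0∞ :=
  ⨆ μ ∈ covertInputs ν, mutualInfo μ (mainChannel θm)

/-- `μ` is an optimal input: it satisfies the covertness constraint and attains `A(ν)`. -/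
def IsOptimalInput (θm ν : ℝ) (μ : ProbabilityMeasure ℝ≥0) : Prop :=
  μ ∈ covertInputs ν ∧ mutualInfo μ (mainChannel θm) = covertValue θm ν

namespace RayleighCovert

open Filter Topology

/-! ### Exponential integrals and pointwise bounds on the transition density -/

/-! Write s = 1 + θ²x for the output mean. For inputs of finite mean, mutual information and warden
divergence become real functionals: `rate` is output entropy minus the mean of 1 + log s, and `cost`
is the warden's mean output minus its output entropy. `rate` is concave and `cost` convex. The
divergence constraint itself bounds the mean (`mean_bound_of_mem_covertInputs`), so no other inputs
matter.

Existence (`exists_rate_max`): the mean bound gives tightness, hence compactness; the constraint is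
closed by Fatou, and the rate is upper semicontinuous. Uniqueness (`eq_of_rate_max`): the output
entropy is strictly concave in the output density, and the density determines the input law because
its values at integers are moments of exp(-1/s).

Finite support: as ν → 0 the feasible means, hence the feasible rates, tend to 0, while some fixed
input has positive rate. So for small ν there is a multiplier l > 0 (`exists_lagrange_multiplier`),
and the Lagrangian density is at most a constant C, with equality on the support. A positive l makes
the support bounded: far-out mass would flatten the cross entropies until the linear penalty wins.
If the support were infinite it would have an accumulation point, and by analyticity the equality
would hold on the whole domain of holomorphy, including negative x (`lagrangian_identity`). Let t =
1 + x be the warden's output mean.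

If θ ≥ 1, letting s → 0 makes -log s blow up while the cross entropies stay nonnegative: a
contradiction. If θ < 1, s stays positive as t → 0, so the identity makes the warden's cross entropy
a convergent power series in t at 0. Inverting the Laplace transform, -log of the warden's output
density is the Borel transform of that series, hence entire. The density is then a zero-free entire
function bounded by exp|z|, so its logarithm is affine by Borel–Carathéodory; the output is
exponential and the input a point mass, contradicting infinite support. -/

theorem integral_exp_mul_pow {s : ℝ} (hs : 0 < s) (n : ℕ) :
    ∫ y in Ici (0 : ℝ), 1 / s * Real.exp (-(y / s)) * y ^ n = n.factorial * s ^ n := by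
  have h := Real.integral_rpow_mul_exp_neg_mul_Ioi (a := n + 1) (r := 1 / s)
    (by positivity) (by positivity)
  rw [integral_Ici_eq_integral_Ioi]
  calc ∫ y in Ioi (0 : ℝ), 1 / s * Real.exp (-(y / s)) * y ^ n
      = ∫ y in Ioi (0 : ℝ), 1 / s * (y ^ ((n : ℝ) + 1 - 1) * Real.exp (-(1 / s * y))) := by
        refine setIntegral_congr_fun measurableSet_Ioi fun y hy => ?_
        have h1 : -(1 / s * y) = -(y / s) := by ring
        simp only [add_sub_cancel_right, Real.rpow_natCast, h1]
        ring
    _ = n.factorial * s ^ n := by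
        rw [integral_const_mul, h, Real.Gamma_nat_eq_factorial]
        have : (1 / (1 / s)) ^ ((n : ℝ) + 1) = s ^ (n + 1) := by
          rw [one_div_one_div, ← Real.rpow_natCast]; push_cast; rfl
        rw [this]
        field_simp
        ring

theorem integrableOn_exp_mul_pow {s : ℝ} (hs : 0 < s) (n : ℕ) :
    IntegrableOn (fun y : ℝ => 1 / s * Real.exp (-(y / s)) * y ^ n) (Ici 0) := by
  -- A non-integrable function has integral 0 by convention, so the nonzero value just computed
  -- yields integrability.
  refine not_imp_comm.1 integral_undef ?_
  rw [integral_exp_mul_pow hs n]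
  positivity

/-- The mean `1 + θ² x` of the output at input `x`. -/
noncomputable def outScale (θ : ℝ) (x : ℝ≥0) : ℝ := θ ^ 2 * x + 1

theorem one_le_outScale (θ : ℝ) (x : ℝ≥0) : 1 ≤ outScale θ x := by
  unfold outScale; nlinarith [mul_nonneg (sq_nonneg θ) x.2]

theorem outScale_pos (θ : ℝ) (x : ℝ≥0) : 0 < outScale θ x :=
  zero_lt_one.trans_le (one_le_outScale θ x)

theorem outScale_mono (θ : ℝ) {a b : ℝ≥0} (h : a ≤ b) : outScale θ a ≤ outScale θ b := by
  unfold outScale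
  have : (a : ℝ) ≤ b := h
  gcongr

@[fun_prop]
theorem continuous_outScale (θ : ℝ) : Continuous (outScale θ) := by
  unfold outScale; fun_prop

theorem rayleighPDF_eq (θ : ℝ) (x : ℝ≥0) (y : ℝ) :
    rayleighPDF θ x y = 1 / outScale θ x * Real.exp (-(y / outScale θ x)) := rfl

theorem rayleighPDF_pos (θ : ℝ) (x : ℝ≥0) (y : ℝ) : 0 < rayleighPDF θ x y := by
  have := outScale_pos θ x
  rw [rayleighPDF_eq]; positivity

theorem rayleighPDF_le_one (θ : ℝ) (x : ℝ≥0) {y : ℝ} (hy : 0 ≤ y) : rayleighPDF θ x y ≤ 1 := by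
  have h := one_le_outScale θ x
  rw [rayleighPDF_eq]
  refine mul_le_one₀ ((div_le_one (by linarith)).2 h) (Real.exp_pos _).le ?_
  rw [Real.exp_le_one_iff]
  have : 0 ≤ y / outScale θ x := by positivity
  linarith

/-- The bound is linear in `outScale`, so it survives averaging over an input of finite mean; the
power 2 leaves room for an integrable bound on the entropy integrand. -/
theorem rayleighPDF_le_div_sq (θ : ℝ) (x : ℝ≥0) {y : ℝ} (hy : 0 ≤ y) :
    rayleighPDF θ x y ≤ 4 * outScale θ x / (1 + y) ^ 2 := by
  have h := one_le_outScale θ x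
  rw [rayleighPDF_eq]
  set s := outScale θ x
  have hs : 0 < s := by linarith
  have hw : 0 ≤ y / s := by positivity
  have h1 : 1 + y ≤ s * (1 + y / s) := by
    have : s * (y / s) = y := by field_simp
    nlinarith
  -- Square 1 + w/2 ≤ exp(w/2) with w = y/s.
  have h2 : (1 + y / s) ^ 2 ≤ 4 * Real.exp (y / s) := by
    have h3 := Real.add_one_le_exp (y / s / 2)
    have h4 : Real.exp (y / s) = Real.exp (y / s / 2) ^ 2 := by
      rw [← Real.exp_nat_mul]; congr 1; push_cast; ring
    rw [h4]
    nlinarith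
  rw [le_div_iff₀ (by positivity), Real.exp_neg]
  have h5 : (1 + y) ^ 2 ≤ s ^ 2 * (4 * Real.exp (y / s)) :=
    calc (1 + y) ^ 2 ≤ (s * (1 + y / s)) ^ 2 := by gcongr
      _ = s ^ 2 * (1 + y / s) ^ 2 := by ring
      _ ≤ _ := by gcongr
  calc 1 / s * (Real.exp (y / s))⁻¹ * (1 + y) ^ 2
      ≤ 1 / s * (Real.exp (y / s))⁻¹ * (s ^ 2 * (4 * Real.exp (y / s))) := by gcongr
    _ = 4 * s := by field_simp

theorem le_rayleighPDF (θ : ℝ) {a b x : ℝ≥0} (ha : a ≤ x) (hb : x ≤ b) {y : ℝ} (hy : 0 ≤ y) :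
    1 / outScale θ b * Real.exp (-(y / outScale θ a)) ≤ rayleighPDF θ x y := by
  have h1 := outScale_mono θ ha
  have h2 := outScale_mono θ hb
  have := outScale_pos θ a
  have := outScale_pos θ x
  rw [rayleighPDF_eq]
  gcongr

theorem log_rayleighPDF (θ : ℝ) (x : ℝ≥0) (y : ℝ) :
    Real.log (rayleighPDF θ x y) = -Real.log (outScale θ x) - y / outScale θ x := by
  have := outScale_pos θ x
  rw [rayleighPDF_eq, Real.log_mul (by positivity) (by positivity), Real.log_exp, one_div,
    Real.log_inv]
  ring

theorem measurable_rayleighPDF_uncurry (θ : ℝ) :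
    Measurable (fun p : ℝ≥0 × ℝ => rayleighPDF θ p.1 p.2) := by
  unfold rayleighPDF; fun_prop

theorem continuous_rayleighPDF_left (θ : ℝ) (y : ℝ) :
    Continuous (fun x => rayleighPDF θ x y) := by
  simp only [rayleighPDF_eq]
  have h : ∀ x, outScale θ x ≠ 0 := fun x => (outScale_pos θ x).ne'
  fun_prop (disch := exact h)

theorem continuous_rayleighPDF_right (θ : ℝ) (x : ℝ≥0) : Continuous (rayleighPDF θ x) := by
  unfold rayleighPDF; fun_prop

theorem integrableOn_rayleighPDF_mul {θ : ℝ} {x : ℝ≥0} {g : ℝ → ℝ} {a b : ℝ} (hg : Measurable g)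
    (hb : ∀ y, 0 ≤ y → |g y| ≤ a + b * y) :
    IntegrableOn (fun y => rayleighPDF θ x y * g y) (Ici 0) := by
  have hs := outScale_pos θ x
  have h0 := (integrableOn_exp_mul_pow hs 0).const_mul a
  have h1 := (integrableOn_exp_mul_pow hs 1).const_mul b
  refine (h0.add h1).mono'
    ((continuous_rayleighPDF_right θ x).measurable.mul hg).aestronglyMeasurable ?_
  filter_upwards [ae_restrict_mem measurableSet_Ici] with y hy
  have := hb y hy
  have hp := rayleighPDF_pos θ x y
  simp only [Pi.add_apply, pow_zero, pow_one, ← rayleighPDF_eq, norm_mul, Real.norm_eq_abs]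
  rw [abs_of_pos hp]
  nlinarith [mul_le_mul_of_nonneg_left this hp.le]

theorem integrableOn_rayleighPDF (θ : ℝ) (x : ℝ≥0) :
    IntegrableOn (rayleighPDF θ x) (Ici 0) := by
  simpa using integrableOn_rayleighPDF_mul (θ := θ) (x := x) (g := fun _ => 1) (a := 1) (b := 0)
    measurable_const (by simp)

theorem integral_rayleighPDF (θ : ℝ) (x : ℝ≥0) : ∫ y in Ici 0, rayleighPDF θ x y = 1 := by
  simpa [rayleighPDF_eq] using integral_exp_mul_pow (outScale_pos θ x) 0

theorem integrableOn_rayleighPDF_mul_self (θ : ℝ) (x : ℝ≥0) :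
    IntegrableOn (fun y => rayleighPDF θ x y * y) (Ici 0) :=
  integrableOn_rayleighPDF_mul (a := 0) (b := 1) measurable_id
    (fun y hy => by simp [abs_of_nonneg hy])

theorem integral_rayleighPDF_mul_self (θ : ℝ) (x : ℝ≥0) :
    ∫ y in Ici 0, rayleighPDF θ x y * y = outScale θ x := by
  simpa [rayleighPDF_eq] using integral_exp_mul_pow (outScale_pos θ x) 1

theorem integral_rayleighPDF_mul_le {θ : ℝ} {x : ℝ≥0} {g : ℝ → ℝ} {a b : ℝ} (hg : Measurable g)
    (hb : ∀ y, 0 ≤ y → |g y| ≤ a + b * y) :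
    ∫ y in Ici 0, |rayleighPDF θ x y * g y| ≤ a + b * outScale θ x := by
  have h1 : ∫ y in Ici 0, (rayleighPDF θ x y * a + rayleighPDF θ x y * y * b)
      = a + b * outScale θ x := by
    rw [integral_add ((integrableOn_rayleighPDF θ x).mul_const _)
      ((integrableOn_rayleighPDF_mul_self θ x).mul_const _), integral_mul_const, integral_mul_const,
      integral_rayleighPDF, integral_rayleighPDF_mul_self]
    ring
  rw [← h1]
  refine setIntegral_mono_on (integrableOn_rayleighPDF_mul hg hb).abs
    (((integrableOn_rayleighPDF θ x).mul_const _).add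
      ((integrableOn_rayleighPDF_mul_self θ x).mul_const _)) measurableSet_Ici fun y hy => ?_
  have hp := rayleighPDF_pos θ x y
  rw [abs_mul, abs_of_pos hp]
  nlinarith [mul_le_mul_of_nonneg_left (hb y hy) hp.le]

/-! ### The output density -/

/-- The output density of the channel `rayleighChannel θ` with input law `μ`. -/
noncomputable def outPDF (θ : ℝ) (μ : Measure ℝ≥0) (y : ℝ) : ℝ := ∫ x, rayleighPDF θ x y ∂μ

/-- The input law has finite mean. -/
def FiniteMean (μ : Measure ℝ≥0) : Prop := Integrable (fun x : ℝ≥0 => (x : ℝ)) μ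

section OutPDF

variable {θ : ℝ} {μ : Measure ℝ≥0}

theorem integrable_rayleighPDF_left [IsFiniteMeasure μ] {y : ℝ} (hy : 0 ≤ y) :
    Integrable (fun x => rayleighPDF θ x y) μ := by
  refine (integrable_const (1 : ℝ)).mono'
    (continuous_rayleighPDF_left θ y).aestronglyMeasurable (ae_of_all _ fun x => ?_)
  rw [Real.norm_eq_abs, abs_of_pos (rayleighPDF_pos θ x y)]
  exact rayleighPDF_le_one θ x hy

theorem measurable_outPDF [SFinite μ] : Measurable (outPDF θ μ) :=
  ((measurable_rayleighPDF_uncurry θ).stronglyMeasurable.integral_prod_left'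
    (f := fun p : ℝ≥0 × ℝ => rayleighPDF θ p.1 p.2)).measurable

theorem outPDF_nonneg (y : ℝ) : 0 ≤ outPDF θ μ y :=
  integral_nonneg fun x => (rayleighPDF_pos θ x y).le

theorem outPDF_pos [IsProbabilityMeasure μ] {y : ℝ} (hy : 0 ≤ y) : 0 < outPDF θ μ y := by
  refine (integral_pos_iff_support_of_nonneg (fun x => (rayleighPDF_pos θ x y).le)
    (integrable_rayleighPDF_left hy)).2 ?_
  have : Function.support (fun x => rayleighPDF θ x y) = univ :=
    eq_univ_of_forall fun x => (rayleighPDF_pos θ x y).ne'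
  simp [this]

theorem outPDF_le_one [IsProbabilityMeasure μ] {y : ℝ} (hy : 0 ≤ y) : outPDF θ μ y ≤ 1 := by
  calc outPDF θ μ y ≤ ∫ _, (1 : ℝ) ∂μ :=
        integral_mono (integrable_rayleighPDF_left hy) (integrable_const _)
          fun x => rayleighPDF_le_one θ x hy
    _ = 1 := by simp

theorem neg_log_outPDF_nonneg [IsProbabilityMeasure μ] {y : ℝ} (hy : 0 ≤ y) :
    0 ≤ -Real.log (outPDF θ μ y) := by
  have := Real.log_nonpos (outPDF_nonneg (θ := θ) (μ := μ) y) (outPDF_le_one hy)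
  linarith

theorem FiniteMean.integrable_outScale [IsFiniteMeasure μ] (h : FiniteMean μ) :
    Integrable (outScale θ) μ :=
  (Integrable.const_mul h (θ ^ 2)).add (integrable_const 1)

theorem FiniteMean.integral_outScale [IsProbabilityMeasure μ] (h : FiniteMean μ) :
    ∫ x, outScale θ x ∂μ = θ ^ 2 * (∫ x, (x : ℝ) ∂μ) + 1 := by
  unfold outScale
  rw [integral_add (Integrable.const_mul h _) (integrable_const _), integral_const_mul]
  simp

theorem outPDF_le_div_sq [IsProbabilityMeasure μ] (h : FiniteMean μ) {y : ℝ} (hy : 0 ≤ y) :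
    outPDF θ μ y ≤ 4 * (θ ^ 2 * (∫ x, (x : ℝ) ∂μ) + 1) / (1 + y) ^ 2 := by
  rw [← h.integral_outScale, ← integral_const_mul, ← integral_div]
  exact integral_mono (integrable_rayleighPDF_left hy)
    ((h.integrable_outScale.const_mul _).div_const _) fun x => rayleighPDF_le_div_sq θ x hy

theorem le_outPDF [IsFiniteMeasure μ] (a b : ℝ≥0) {y : ℝ} (hy : 0 ≤ y) :
    μ.real (Icc a b) / outScale θ b * Real.exp (-(y / outScale θ a)) ≤ outPDF θ μ y := by
  calc μ.real (Icc a b) / outScale θ b * Real.exp (-(y / outScale θ a))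
      = ∫ _ in Icc a b, 1 / outScale θ b * Real.exp (-(y / outScale θ a)) ∂μ := by
        rw [setIntegral_const, smul_eq_mul]; ring
    _ ≤ ∫ x in Icc a b, rayleighPDF θ x y ∂μ :=
        setIntegral_mono_on (integrable_const _) (integrable_rayleighPDF_left hy).integrableOn
          measurableSet_Icc fun x hx => le_rayleighPDF θ hx.1 hx.2 hy
    _ ≤ outPDF θ μ y := setIntegral_le_integral (integrable_rayleighPDF_left hy)
        (ae_of_all _ fun x => (rayleighPDF_pos θ x y).le)

/-- Mass in [a, b] caps the growth of -log of the density at slope 1/`outScale θ a`: slope 1 is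
always available from a = 0, and mass far out makes the slope small, which later bounds the support.
-/
theorem neg_log_outPDF_le [IsProbabilityMeasure μ] {a b : ℝ≥0} (hab : 0 < μ.real (Icc a b)) {y : ℝ}
    (hy : 0 ≤ y) :
    -Real.log (outPDF θ μ y) ≤ -Real.log (μ.real (Icc a b) / outScale θ b) + y / outScale θ a := by
  have hb := outScale_pos θ b
  have h := Real.log_le_log (by positivity) (le_outPDF (θ := θ) (μ := μ) a b hy)
  rw [Real.log_mul (by positivity) (by positivity), Real.log_exp] at h
  linarith

theorem exists_measureReal_Icc_pos [IsProbabilityMeasure μ] : ∃ b, 0 < μ.real (Icc 0 b) := by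
  by_contra! h
  have h1 : ∀ n : ℕ, μ (Icc 0 (n : ℝ≥0)) = 0 := fun n =>
    (measureReal_eq_zero_iff).1 (le_antisymm (h n) measureReal_nonneg)
  have h2 : (⋃ n : ℕ, Icc 0 (n : ℝ≥0)) = univ := by
    refine eq_univ_of_forall fun x => mem_iUnion.2 ?_
    obtain ⟨n, hn⟩ := exists_nat_ge x
    exact ⟨n, bot_le, hn⟩
  have h3 := measure_iUnion_null h1
  rw [h2] at h3
  simp at h3

theorem exists_neg_log_outPDF_le [IsProbabilityMeasure μ] :
    ∃ c, 0 ≤ c ∧ ∀ y, 0 ≤ y → |Real.log (outPDF θ μ y)| ≤ c + 1 * y := by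
  obtain ⟨b, hb⟩ := exists_measureReal_Icc_pos (μ := μ)
  refine ⟨max 0 (-Real.log (μ.real (Icc 0 b) / outScale θ b)), le_max_left _ _, fun y hy => ?_⟩
  have h := neg_log_outPDF_le (θ := θ) hb hy
  have h0 : outScale θ 0 = 1 := by simp [outScale]
  rw [h0, div_one] at h
  rw [← abs_neg, abs_of_nonneg (neg_log_outPDF_nonneg hy)]
  linarith [le_max_right 0 (-Real.log (μ.real (Icc 0 b) / outScale θ b))]

theorem measurable_log_outPDF [SFinite μ] : Measurable fun y => Real.log (outPDF θ μ y) :=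
  Real.measurable_log.comp measurable_outPDF

/-! ### Exchanging the order of integration -/

theorem integrable_prod_rayleighPDF_mul [IsProbabilityMeasure μ] (h : FiniteMean μ) {g : ℝ → ℝ}
    {a b : ℝ} (hg : Measurable g) (hb : ∀ y, 0 ≤ y → |g y| ≤ a + b * y) :
    Integrable (fun p : ℝ≥0 × ℝ => rayleighPDF θ p.1 p.2 * g p.2)
      (μ.prod (volume.restrict (Ici 0))) := by
  have hm : Measurable (fun p : ℝ≥0 × ℝ => rayleighPDF θ p.1 p.2 * g p.2) :=
    (measurable_rayleighPDF_uncurry θ).mul (hg.comp measurable_snd)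
  rw [integrable_prod_iff hm.aestronglyMeasurable]
  refine ⟨ae_of_all _ fun x => integrableOn_rayleighPDF_mul hg hb, ?_⟩
  refine ((integrable_const a).add (h.integrable_outScale (θ := θ) |>.const_mul b)).mono'
    hm.norm.stronglyMeasurable.integral_prod_right'.aestronglyMeasurable (ae_of_all _ fun x => ?_)
  rw [Real.norm_of_nonneg (integral_nonneg fun _ => norm_nonneg _)]
  exact integral_rayleighPDF_mul_le hg hb

theorem integrableOn_outPDF_mul [IsProbabilityMeasure μ] (h : FiniteMean μ) {g : ℝ → ℝ} {a b : ℝ}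
    (hg : Measurable g) (hb : ∀ y, 0 ≤ y → |g y| ≤ a + b * y) :
    IntegrableOn (fun y => outPDF θ μ y * g y) (Ici 0) := by
  refine (integrable_prod_rayleighPDF_mul (θ := θ) h hg hb).integral_prod_right.congr
    (ae_of_all _ fun y => ?_)
  simp only [outPDF, integral_mul_const]

theorem integral_outPDF_mul [IsProbabilityMeasure μ] (h : FiniteMean μ) {g : ℝ → ℝ} {a b : ℝ}
    (hg : Measurable g) (hb : ∀ y, 0 ≤ y → |g y| ≤ a + b * y) :
    ∫ y in Ici 0, outPDF θ μ y * g y = ∫ x, (∫ y in Ici (0 : ℝ), rayleighPDF θ x y * g y) ∂μ := by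
  rw [integral_integral_swap (f := fun x y => rayleighPDF θ x y * g y)
    (integrable_prod_rayleighPDF_mul h hg hb)]
  refine integral_congr_ae (ae_of_all _ fun y => ?_)
  simp only [outPDF, integral_mul_const]

theorem integrableOn_outPDF [IsProbabilityMeasure μ] (h : FiniteMean μ) :
    IntegrableOn (outPDF θ μ) (Ici 0) := by
  simpa using integrableOn_outPDF_mul (θ := θ) h (g := fun _ => 1) (a := 1) (b := 0)
    measurable_const (by simp)

theorem integral_outPDF [IsProbabilityMeasure μ] (h : FiniteMean μ) :
    ∫ y in Ici 0, outPDF θ μ y = 1 := by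
  simpa [integral_rayleighPDF] using integral_outPDF_mul (θ := θ) h (g := fun _ => 1) (a := 1)
    (b := 0) measurable_const (by simp)

theorem integrableOn_outPDF_mul_self [IsProbabilityMeasure μ] (h : FiniteMean μ) :
    IntegrableOn (fun y => outPDF θ μ y * y) (Ici 0) :=
  integrableOn_outPDF_mul h (a := 0) (b := 1) measurable_id
    (fun y hy => by simp [abs_of_nonneg hy])

theorem integral_outPDF_mul_self [IsProbabilityMeasure μ] (h : FiniteMean μ) :
    ∫ y in Ici 0, outPDF θ μ y * y = θ ^ 2 * (∫ x, (x : ℝ) ∂μ) + 1 := by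
  rw [integral_outPDF_mul (θ := θ) h (g := fun y => y) (a := 0) (b := 1) measurable_id
    (fun y hy => by simp [abs_of_nonneg hy]), ← h.integral_outScale]
  simp only [integral_rayleighPDF_mul_self]

end OutPDF

/-! ### Relative entropy of measures given by densities -/

/-- Pointwise nonnegativity of the relative entropy integrand; it drives Gibbs' inequality and the
mean bound. -/
theorem mul_log_sub_nonneg {a b : ℝ} (ha : 0 < a) (hb : 0 < b) :
    0 ≤ a * Real.log a - a * Real.log b + b - a := by
  have h := Real.log_le_sub_one_of_pos (div_pos hb ha)
  rw [Real.log_div hb.ne' ha.ne'] at h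
  have h1 : a * (Real.log b - Real.log a) ≤ a * (b / a - 1) := mul_le_mul_of_nonneg_left h ha.le
  have h2 : a * (b / a - 1) = b - a := by field_simp
  linarith

/-- The correction g - f keeps the integrand nonnegative, so the formula needs no integrability and
also covers infinite divergence. -/
theorem klDiv_withDensity {α : Type*} [MeasurableSpace α] {m : Measure α} [SigmaFinite m]
    {f g : α → ℝ} (hf : Measurable f) (hg : Measurable g) (hf0 : ∀ᵐ x ∂m, 0 < f x)
    (hg0 : ∀ᵐ x ∂m, 0 < g x)
    [IsFiniteMeasure (m.withDensity fun x => ENNReal.ofReal (f x))]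
    [IsFiniteMeasure (m.withDensity fun x => ENNReal.ofReal (g x))] :
    klDiv (m.withDensity fun x => ENNReal.ofReal (f x))
        (m.withDensity fun x => ENNReal.ofReal (g x)) =
      ∫⁻ x, ENNReal.ofReal (f x * Real.log (f x) - f x * Real.log (g x) + g x - f x) ∂m := by
  have hfg : Measurable fun x => ENNReal.ofReal (f x / g x) := (hf.div hg).ennreal_ofReal
  have h1 : m.withDensity (fun x => ENNReal.ofReal (f x)) =
      (m.withDensity fun x => ENNReal.ofReal (g x)).withDensity
        fun x => ENNReal.ofReal (f x / g x) := by
    rw [← withDensity_mul _ hg.ennreal_ofReal hfg]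
    refine withDensity_congr_ae ?_
    filter_upwards [hg0] with x hx
    rw [Pi.mul_apply, ← ENNReal.ofReal_mul hx.le]
    congr 1
    field_simp
  have hac : m.withDensity (fun x => ENNReal.ofReal (f x)) ≪
      m.withDensity fun x => ENNReal.ofReal (g x) := by
    rw [h1]; exact withDensity_absolutelyContinuous _ _
  have hrn : (m.withDensity fun x => ENNReal.ofReal (f x)).rnDeriv
      (m.withDensity fun x => ENNReal.ofReal (g x)) =ᵐ[m.withDensity fun x => ENNReal.ofReal (g x)]
        fun x => ENNReal.ofReal (f x / g x) := by
    conv_lhs => rw [h1]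
    exact Measure.rnDeriv_withDensity _ hfg
  rw [klDiv_eq_lintegral_klFun_of_ac hac]
  have h2 : ∫⁻ x, ENNReal.ofReal (klFun ((m.withDensity fun x => ENNReal.ofReal (f x)).rnDeriv
      (m.withDensity fun x => ENNReal.ofReal (g x)) x).toReal)
        ∂(m.withDensity fun x => ENNReal.ofReal (g x)) =
      ∫⁻ x, ENNReal.ofReal (klFun (ENNReal.ofReal (f x / g x)).toReal)
        ∂(m.withDensity fun x => ENNReal.ofReal (g x)) := by
    refine lintegral_congr_ae ?_
    filter_upwards [hrn] with x hx
    rw [hx]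
  rw [h2, lintegral_withDensity_eq_lintegral_mul m
    (f := fun x => ENNReal.ofReal (g x))
    (g := fun x => ENNReal.ofReal (klFun (ENNReal.ofReal (f x / g x)).toReal)) hg.ennreal_ofReal
    (measurable_klFun.comp hfg.ennreal_toReal).ennreal_ofReal]
  refine lintegral_congr_ae ?_
  filter_upwards [hf0, hg0] with x hx hx'
  rw [Pi.mul_apply, ENNReal.toReal_ofReal (by positivity), ← ENNReal.ofReal_mul hx'.le, klFun_apply,
    Real.log_div hx.ne' hx'.ne']
  congr 1
  field_simp

theorem integral_add_add_sub {α : Type*} [MeasurableSpace α] {m : Measure α} {f g h k : α → ℝ}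
    (hf : Integrable f m) (hg : Integrable g m) (hh : Integrable h m) (hk : Integrable k m) :
    Integrable (fun x => f x + g x + h x - k x) m ∧
      ∫ x, (f x + g x + h x - k x) ∂m = ∫ x, f x ∂m + ∫ x, g x ∂m + ∫ x, h x ∂m - ∫ x, k x ∂m := by
  have i1 : Integrable (fun x => f x + g x) m := hf.add hg
  have i2 : Integrable (fun x => f x + g x + h x) m := i1.add hh
  refine ⟨i2.sub hk, ?_⟩
  rw [integral_sub i2 hk, integral_add i1 hh, integral_add hf hg]

theorem integral_add_sub' {α : Type*} [MeasurableSpace α] {m : Measure α} {f g h : α → ℝ}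
    (hf : Integrable f m) (hg : Integrable g m) (hh : Integrable h m) :
    Integrable (fun x => f x + g x - h x) m ∧
      ∫ x, (f x + g x - h x) ∂m = ∫ x, f x ∂m + ∫ x, g x ∂m - ∫ x, h x ∂m := by
  have i1 : Integrable (fun x => f x + g x) m := hf.add hg
  refine ⟨i1.sub hh, ?_⟩
  rw [integral_sub i1 hh, integral_add hf hg]

/-! ### Output laws as measures with density -/

section OutputLaw

variable {θ : ℝ} {μ : Measure ℝ≥0}

theorem rayleighChannel_apply (θ : ℝ) (x : ℝ≥0) :
    rayleighChannel θ x = (volume.restrict (Ici (0 : ℝ))).withDensity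
      fun y => ENNReal.ofReal (rayleighPDF θ x y) := rfl

theorem lintegral_rayleighChannel (θ : ℝ) (x : ℝ≥0) {φ : ℝ → ℝ≥0∞} (hφ : Measurable φ) :
    ∫⁻ y, φ y ∂(rayleighChannel θ x) =
      ∫⁻ y in Ici (0 : ℝ), ENNReal.ofReal (rayleighPDF θ x y) * φ y := by
  rw [rayleighChannel_apply, lintegral_withDensity_eq_lintegral_mul _
    (continuous_rayleighPDF_right θ x).measurable.ennreal_ofReal hφ]
  rfl

theorem rayleighChannel_comp [IsProbabilityMeasure μ] :
    rayleighChannel θ ∘ₘ μ = (volume.restrict (Ici (0 : ℝ))).withDensity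
      fun y => ENNReal.ofReal (outPDF θ μ y) := by
  refine Measure.ext_of_lintegral _ fun φ hφ => ?_
  rw [Measure.lintegral_bind (Kernel.aemeasurable _) hφ.aemeasurable,
    lintegral_withDensity_eq_lintegral_mul _ measurable_outPDF.ennreal_ofReal hφ]
  simp only [lintegral_rayleighChannel θ _ hφ]
  rw [lintegral_lintegral_swap]
  · refine lintegral_congr_ae ?_
    filter_upwards [ae_restrict_mem measurableSet_Ici] with y hy
    rw [lintegral_mul_const _
      (continuous_rayleighPDF_left θ y).measurable.ennreal_ofReal, Pi.mul_apply,
      ← ofReal_integral_eq_lintegral_ofReal (integrable_rayleighPDF_left hy)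
        (ae_of_all _ fun x => (rayleighPDF_pos θ x y).le)]
    rfl
  · exact ((measurable_rayleighPDF_uncurry θ).ennreal_ofReal.mul
      (hφ.comp measurable_snd)).aemeasurable

theorem compProd_rayleighChannel [IsProbabilityMeasure μ] :
    μ ⊗ₘ rayleighChannel θ = (μ.prod (volume.restrict (Ici (0 : ℝ)))).withDensity
      fun p => ENNReal.ofReal (rayleighPDF θ p.1 p.2) := by
  refine Measure.ext_of_lintegral _ fun φ hφ => ?_
  rw [Measure.lintegral_compProd hφ, lintegral_withDensity_eq_lintegral_mul _
    (measurable_rayleighPDF_uncurry θ).ennreal_ofReal hφ, lintegral_prod]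
  · refine lintegral_congr fun x => ?_
    rw [lintegral_rayleighChannel θ _ (φ := fun y => φ (x, y)) (hφ.comp measurable_prodMk_left)]
    rfl
  · exact ((measurable_rayleighPDF_uncurry θ).ennreal_ofReal.mul hφ).aemeasurable

theorem prod_rayleighChannel_comp [IsProbabilityMeasure μ] :
    μ.prod (rayleighChannel θ ∘ₘ μ) = (μ.prod (volume.restrict (Ici (0 : ℝ)))).withDensity
      fun p => ENNReal.ofReal (outPDF θ μ p.2) := by
  rw [rayleighChannel_comp, prod_withDensity_right measurable_outPDF.ennreal_ofReal]

/-! ### Entropy functionals -/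

/-- The cross entropy of the output law at input `x` relative to the output law of `μ`. -/
noncomputable def crossEnt (θ : ℝ) (μ : Measure ℝ≥0) (x : ℝ≥0) : ℝ :=
  ∫ y in Ici (0 : ℝ), rayleighPDF θ x y * -Real.log (outPDF θ μ y)

/-- The differential entropy of the output law of `μ`. -/
noncomputable def outEntropy (θ : ℝ) (μ : Measure ℝ≥0) : ℝ :=
  ∫ y in Ici (0 : ℝ), Real.negMulLog (outPDF θ μ y)

/-- The mutual information as a real number, for inputs with finite mean. -/
noncomputable def rate (θ : ℝ) (μ : Measure ℝ≥0) : ℝ :=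
  outEntropy θ μ - 1 - ∫ x, Real.log (outScale θ x) ∂μ

/-- The divergence at the warden as a real number, for inputs with finite mean. -/
noncomputable def cost (μ : Measure ℝ≥0) : ℝ := ∫ x, (x : ℝ) ∂μ + 1 - outEntropy 1 μ

theorem abs_neg_log_outPDF_le [IsProbabilityMeasure μ] :
    ∃ c, 0 ≤ c ∧ ∀ y, 0 ≤ y → |-Real.log (outPDF θ μ y)| ≤ c + 1 * y := by
  simpa only [abs_neg] using exists_neg_log_outPDF_le (θ := θ) (μ := μ)

theorem integrableOn_crossEnt [IsProbabilityMeasure μ] {η : ℝ} (x : ℝ≥0) :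
    IntegrableOn (fun y => rayleighPDF η x y * -Real.log (outPDF θ μ y)) (Ici 0) := by
  obtain ⟨c, -, hc⟩ := abs_neg_log_outPDF_le (θ := θ) (μ := μ)
  exact integrableOn_rayleighPDF_mul measurable_log_outPDF.neg hc

theorem integrable_crossEnt [IsProbabilityMeasure μ] {μ' : Measure ℝ≥0} [IsProbabilityMeasure μ']
    (h : FiniteMean μ) : Integrable (crossEnt θ μ') μ := by
  obtain ⟨c, -, hc⟩ := abs_neg_log_outPDF_le (θ := θ) (μ := μ')
  exact (integrable_prod_rayleighPDF_mul h measurable_log_outPDF.neg hc).integral_prod_left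

theorem integrableOn_outPDF_mul_log [IsProbabilityMeasure μ] {μ' : Measure ℝ≥0}
    [IsProbabilityMeasure μ'] (h : FiniteMean μ) :
    IntegrableOn (fun y => outPDF θ μ y * -Real.log (outPDF θ μ' y)) (Ici 0) := by
  obtain ⟨c, -, hc⟩ := abs_neg_log_outPDF_le (θ := θ) (μ := μ')
  exact integrableOn_outPDF_mul h measurable_log_outPDF.neg hc

theorem integral_outPDF_mul_log [IsProbabilityMeasure μ] {μ' : Measure ℝ≥0}
    [IsProbabilityMeasure μ'] (h : FiniteMean μ) :
    ∫ y in Ici 0, outPDF θ μ y * -Real.log (outPDF θ μ' y) = ∫ x, crossEnt θ μ' x ∂μ := by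
  obtain ⟨c, -, hc⟩ := abs_neg_log_outPDF_le (θ := θ) (μ := μ')
  exact integral_outPDF_mul h measurable_log_outPDF.neg hc

theorem negMulLog_eq_mul_neg_log (a : ℝ) : Real.negMulLog a = a * -Real.log a := by
  rw [Real.negMulLog]; ring

theorem integrableOn_negMulLog_outPDF [IsProbabilityMeasure μ] (h : FiniteMean μ) :
    IntegrableOn (fun y => Real.negMulLog (outPDF θ μ y)) (Ici 0) := by
  simpa only [negMulLog_eq_mul_neg_log] using integrableOn_outPDF_mul_log (μ' := μ) h

theorem outEntropy_eq_integral_crossEnt [IsProbabilityMeasure μ] (h : FiniteMean μ) :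
    outEntropy θ μ = ∫ x, crossEnt θ μ x ∂μ := by
  simp only [outEntropy, negMulLog_eq_mul_neg_log, integral_outPDF_mul_log h]

/-- **Gibbs' inequality** for output densities. -/
theorem outEntropy_le_integral_crossEnt [IsProbabilityMeasure μ] {μ' : Measure ℝ≥0}
    [IsProbabilityMeasure μ'] (h : FiniteMean μ) (h' : FiniteMean μ') :
    outEntropy θ μ ≤ ∫ x, crossEnt θ μ' x ∂μ := by
  have h1 : ∫ y in Ici (0 : ℝ), (outPDF θ μ y * -Real.log (outPDF θ μ' y) + outPDF θ μ' y
      - outPDF θ μ y) = ∫ x, crossEnt θ μ' x ∂μ := by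
    have i1 := integrableOn_outPDF_mul_log (θ := θ) (μ' := μ') h
    rw [(integral_add_sub' i1 (integrableOn_outPDF h') (integrableOn_outPDF h)).2,
      integral_outPDF h, integral_outPDF h', integral_outPDF_mul_log h]
    ring
  rw [← h1]
  refine setIntegral_mono_on (integrableOn_negMulLog_outPDF h)
    (((integrableOn_outPDF_mul_log h).add (integrableOn_outPDF h')).sub (integrableOn_outPDF h))
    measurableSet_Ici fun y hy => ?_
  have := mul_log_sub_nonneg (outPDF_pos (θ := θ) (μ := μ) hy) (outPDF_pos (θ := θ) (μ := μ') hy)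
  rw [negMulLog_eq_mul_neg_log]
  linarith

theorem integrable_log_outScale [IsProbabilityMeasure μ] (h : FiniteMean μ) :
    Integrable (fun x => Real.log (outScale θ x)) μ := by
  refine (h.integrable_outScale (θ := θ)).mono'
    (Real.measurable_log.comp (continuous_outScale θ).measurable).aestronglyMeasurable
    (ae_of_all _ fun x => ?_)
  rw [Real.norm_of_nonneg (Real.log_nonneg (one_le_outScale θ x))]
  exact Real.log_le_self (outScale_pos θ x).le

theorem integral_mul_log_rayleighPDF (θ : ℝ) (x : ℝ≥0) :
    IntegrableOn (fun y => rayleighPDF θ x y * Real.log (rayleighPDF θ x y)) (Ici 0) ∧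
    ∫ y in Ici 0, rayleighPDF θ x y * Real.log (rayleighPDF θ x y)
      = -1 - Real.log (outScale θ x) := by
  have hs := outScale_pos θ x
  have i0 := (integrableOn_rayleighPDF θ x).mul_const (-Real.log (outScale θ x))
  have i1 := (integrableOn_rayleighPDF_mul_self θ x).mul_const (1 / outScale θ x)
  have h : (fun y => rayleighPDF θ x y * Real.log (rayleighPDF θ x y)) =
      fun y => rayleighPDF θ x y * -Real.log (outScale θ x)
        - rayleighPDF θ x y * y * (1 / outScale θ x) := by
    funext y
    rw [log_rayleighPDF]
    ring
  rw [h]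
  refine ⟨i0.sub i1, ?_⟩
  rw [integral_sub i0 i1, integral_mul_const, integral_mul_const, integral_rayleighPDF,
    integral_rayleighPDF_mul_self]
  field_simp
  ring

/-- This is the divergence of the output law at x from the overall output law; averaging it over x
by Tonelli gives the mutual information. -/
theorem lintegral_klDiv_rayleighPDF [IsProbabilityMeasure μ] (h : FiniteMean μ) (x : ℝ≥0) :
    0 ≤ crossEnt θ μ x - 1 - Real.log (outScale θ x) ∧
    ∫⁻ y in Ici (0 : ℝ), ENNReal.ofReal (rayleighPDF θ x y * Real.log (rayleighPDF θ x y)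
      - rayleighPDF θ x y * Real.log (outPDF θ μ y) + outPDF θ μ y - rayleighPDF θ x y) =
      ENNReal.ofReal (crossEnt θ μ x - 1 - Real.log (outScale θ x)) := by
  obtain ⟨i0, e0⟩ := integral_mul_log_rayleighPDF θ x
  have i1 := integrableOn_crossEnt (θ := θ) (η := θ) (μ := μ) x
  have i2 := integrableOn_outPDF (θ := θ) h
  have i3 := integrableOn_rayleighPDF θ x
  have hn : 0 ≤ᵐ[volume.restrict (Ici (0 : ℝ))]
      fun y => rayleighPDF θ x y * Real.log (rayleighPDF θ x y)
        + rayleighPDF θ x y * -Real.log (outPDF θ μ y) + outPDF θ μ y - rayleighPDF θ x y := by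
    filter_upwards [ae_restrict_mem measurableSet_Ici] with y hy
    have := mul_log_sub_nonneg (rayleighPDF_pos θ x y) (outPDF_pos (θ := θ) (μ := μ) hy)
    simp only [Pi.zero_apply]
    linarith
  have e : ∫ y in Ici (0 : ℝ), (rayleighPDF θ x y * Real.log (rayleighPDF θ x y)
        + rayleighPDF θ x y * -Real.log (outPDF θ μ y) + outPDF θ μ y - rayleighPDF θ x y) =
      crossEnt θ μ x - 1 - Real.log (outScale θ x) := by
    rw [(integral_add_add_sub i0 i1 i2 i3).2, e0, integral_outPDF h, integral_rayleighPDF]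
    simp only [crossEnt]
    ring
  refine ⟨e ▸ integral_nonneg_of_ae hn, ?_⟩
  rw [← e, ofReal_integral_eq_lintegral_ofReal (integral_add_add_sub i0 i1 i2 i3).1 hn]
  refine lintegral_congr fun y => ?_
  congr 1
  ring

theorem integral_crossEnt_sub [IsProbabilityMeasure μ] {μ' : Measure ℝ≥0}
    [IsProbabilityMeasure μ'] (h : FiniteMean μ) :
    Integrable (fun x => crossEnt θ μ' x - 1 - Real.log (outScale θ x)) μ ∧
    ∫ x, (crossEnt θ μ' x - 1 - Real.log (outScale θ x)) ∂μ =
      (∫ x, crossEnt θ μ' x ∂μ) - 1 - ∫ x, Real.log (outScale θ x) ∂μ := by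
  have i1 : Integrable (fun x => crossEnt θ μ' x - 1) μ :=
    (integrable_crossEnt h).sub (integrable_const (1 : ℝ))
  refine ⟨i1.sub (integrable_log_outScale h), ?_⟩
  rw [integral_sub i1 (integrable_log_outScale h),
    integral_sub (integrable_crossEnt h) (integrable_const _)]
  simp

theorem integral_crossEnt_sub_eq_rate [IsProbabilityMeasure μ] (h : FiniteMean μ) :
    ∫ x, (crossEnt θ μ x - 1 - Real.log (outScale θ x)) ∂μ = rate θ μ := by
  rw [(integral_crossEnt_sub h).2, rate, outEntropy_eq_integral_crossEnt h]

theorem rate_nonneg [IsProbabilityMeasure μ] (h : FiniteMean μ) : 0 ≤ rate θ μ := by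
  rw [← integral_crossEnt_sub_eq_rate h]
  exact integral_nonneg fun x => (lintegral_klDiv_rayleighPDF h x).1

theorem mutualInfo_eq_ofReal_rate {P : ProbabilityMeasure ℝ≥0}
    (h : FiniteMean (P : Measure ℝ≥0)) :
    mutualInfo P (mainChannel θ) = ENNReal.ofReal (rate θ (P : Measure ℝ≥0)) := by
  set μ := (P : Measure ℝ≥0)
  have hp := measurable_rayleighPDF_uncurry θ
  have hq : Measurable fun p : ℝ≥0 × ℝ => outPDF θ μ p.2 := measurable_outPDF.comp measurable_snd
  have f1 : IsFiniteMeasure ((μ.prod (volume.restrict (Ici (0 : ℝ)))).withDensity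
      fun p => ENNReal.ofReal (rayleighPDF θ p.1 p.2)) := by
    rw [← compProd_rayleighChannel]; infer_instance
  have f2 : IsFiniteMeasure ((μ.prod (volume.restrict (Ici (0 : ℝ)))).withDensity
      fun p => ENNReal.ofReal (outPDF θ μ p.2)) := by
    rw [← prod_rayleighChannel_comp]; infer_instance
  rw [mutualInfo, compProd_rayleighChannel, prod_rayleighChannel_comp,
    klDiv_withDensity hp hq (ae_of_all _ fun p => rayleighPDF_pos θ p.1 p.2), lintegral_prod]
  · simp only [(lintegral_klDiv_rayleighPDF h _).2]
    rw [← integral_crossEnt_sub_eq_rate h, ofReal_integral_eq_lintegral_ofReal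
      (integral_crossEnt_sub h).1 (ae_of_all _ fun x => (lintegral_klDiv_rayleighPDF h x).1)]
  · exact ((((hp.mul (Real.measurable_log.comp hp)).sub
      (hp.mul (Real.measurable_log.comp hq))).add hq).sub hp).ennreal_ofReal.aemeasurable
  · have hae : ∀ᵐ y ∂(volume.restrict (Ici (0 : ℝ))), 0 < outPDF θ μ y := by
      filter_upwards [ae_restrict_mem measurableSet_Ici] with y hy using outPDF_pos hy
    exact Measure.quasiMeasurePreserving_snd.ae hae

/-! ### The divergence at the warden -/

theorem rayleighPDF_one_zero (y : ℝ) : rayleighPDF 1 0 y = Real.exp (-y) := by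
  simp [rayleighPDF]

/-- Here -log of the reference density is y. The identity is kept in `ℝ≥0∞` because finiteness of
the mean is still to be deduced from it. -/
theorem wardenDivergence_eq_lintegral (P : ProbabilityMeasure ℝ≥0) :
    wardenDivergence P = ∫⁻ y in Ici (0 : ℝ), ENNReal.ofReal
      (outPDF 1 P y * Real.log (outPDF 1 P y) + outPDF 1 P y * y + Real.exp (-y)
        - outPDF 1 P y) := by
  set μ := (P : Measure ℝ≥0)
  have f1 : IsFiniteMeasure ((volume.restrict (Ici (0 : ℝ))).withDensity
      fun y => ENNReal.ofReal (outPDF 1 μ y)) := by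
    rw [← rayleighChannel_comp]; infer_instance
  have f2 : IsFiniteMeasure ((volume.restrict (Ici (0 : ℝ))).withDensity
      fun y => ENNReal.ofReal (rayleighPDF 1 0 y)) := by
    rw [← rayleighChannel_apply]; infer_instance
  rw [wardenDivergence, rayleighChannel_comp, rayleighChannel_apply,
    klDiv_withDensity measurable_outPDF (continuous_rayleighPDF_right 1 0).measurable ?_
    (ae_of_all _ fun y => rayleighPDF_pos 1 0 y)]
  · refine lintegral_congr fun y => ?_
    rw [rayleighPDF_one_zero, Real.log_exp]
    congr 1
    ring
  · filter_upwards [ae_restrict_mem measurableSet_Ici] with y hy using outPDF_pos hy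

theorem cost_integrand [IsProbabilityMeasure μ] (h : FiniteMean μ) :
    IntegrableOn (fun y => outPDF 1 μ y * Real.log (outPDF 1 μ y) + outPDF 1 μ y * y
      + Real.exp (-y) - outPDF 1 μ y) (Ici 0) ∧
    ∫ y in Ici (0 : ℝ), (outPDF 1 μ y * Real.log (outPDF 1 μ y) + outPDF 1 μ y * y
      + Real.exp (-y) - outPDF 1 μ y) = cost μ := by
  have i0 : IntegrableOn (fun y => outPDF 1 μ y * Real.log (outPDF 1 μ y)) (Ici 0) := by
    refine (integrableOn_outPDF_mul_log (θ := 1) (μ' := μ) h).neg.congr (ae_of_all _ fun y => ?_)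
    simp
  have i1 := integrableOn_outPDF_mul_self (θ := 1) h
  have i2 : IntegrableOn (fun y : ℝ => Real.exp (-y)) (Ici 0) := by
    simpa only [← rayleighPDF_one_zero] using integrableOn_rayleighPDF 1 0
  have i3 := integrableOn_outPDF (θ := 1) h
  refine ⟨(integral_add_add_sub i0 i1 i2 i3).1, ?_⟩
  have e0 : ∫ y in Ici (0 : ℝ), outPDF 1 μ y * Real.log (outPDF 1 μ y) = -outEntropy 1 μ := by
    rw [outEntropy, ← integral_neg]
    simp [Real.negMulLog]
  have e2 : ∫ y in Ici (0 : ℝ), Real.exp (-y) = 1 := by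
    simp only [← rayleighPDF_one_zero, integral_rayleighPDF]
  rw [(integral_add_add_sub i0 i1 i2 i3).2, e0, e2, integral_outPDF h, integral_outPDF_mul_self h, cost]
  ring

theorem cost_integrand_nonneg [IsProbabilityMeasure μ] {y : ℝ} (hy : 0 ≤ y) :
    0 ≤ outPDF 1 μ y * Real.log (outPDF 1 μ y) + outPDF 1 μ y * y + Real.exp (-y)
      - outPDF 1 μ y := by
  have := mul_log_sub_nonneg (outPDF_pos (θ := 1) (μ := μ) hy) (Real.exp_pos (-y))
  rw [Real.log_exp] at this
  linarith

theorem wardenDivergence_eq_ofReal_cost {P : ProbabilityMeasure ℝ≥0}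
    (h : FiniteMean (P : Measure ℝ≥0)) :
    wardenDivergence P = ENNReal.ofReal (cost (P : Measure ℝ≥0)) := by
  rw [wardenDivergence_eq_lintegral, ← (cost_integrand h).2,
    ofReal_integral_eq_lintegral_ofReal (cost_integrand h).1]
  filter_upwards [ae_restrict_mem measurableSet_Ici] with y hy using cost_integrand_nonneg hy

theorem lintegral_outPDF_mul_self [IsProbabilityMeasure μ] :
    ∫⁻ y in Ici (0 : ℝ), ENNReal.ofReal (outPDF θ μ y * y) =
      ∫⁻ x, ENNReal.ofReal (outScale θ x) ∂μ := by
  have hm : Measurable fun y : ℝ => ENNReal.ofReal y := ENNReal.measurable_ofReal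
  calc ∫⁻ y in Ici (0 : ℝ), ENNReal.ofReal (outPDF θ μ y * y)
      = ∫⁻ y, ENNReal.ofReal y ∂(rayleighChannel θ ∘ₘ μ) := by
        rw [rayleighChannel_comp,
          lintegral_withDensity_eq_lintegral_mul _ measurable_outPDF.ennreal_ofReal hm]
        refine lintegral_congr fun y => ?_
        rw [Pi.mul_apply, ENNReal.ofReal_mul (outPDF_nonneg y)]
    _ = ∫⁻ x, ∫⁻ y, ENNReal.ofReal y ∂(rayleighChannel θ x) ∂μ :=
        Measure.lintegral_bind (Kernel.aemeasurable _) hm.aemeasurable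
    _ = ∫⁻ x, ENNReal.ofReal (outScale θ x) ∂μ := by
        refine lintegral_congr fun x => ?_
        rw [lintegral_rayleighChannel θ x hm, ← integral_rayleighPDF_mul_self,
          ofReal_integral_eq_lintegral_ofReal (integrableOn_rayleighPDF_mul_self θ x)]
        · simp only [ENNReal.ofReal_mul (rayleighPDF_pos θ x _).le]
        · filter_upwards [ae_restrict_mem measurableSet_Ici] with y hy
          exact mul_nonneg (rayleighPDF_pos θ x y).le hy

/-- A bound on the divergence at the warden forces a bound on the mean of the input. -/
theorem mean_bound_of_mem_covertInputs {ν δ : ℝ} (hν : 0 ≤ ν) (hδ : 0 < δ) (hδ1 : δ < 1)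
    {P : ProbabilityMeasure ℝ≥0} (hP : P ∈ covertInputs ν) :
    FiniteMean (P : Measure ℝ≥0) ∧
      ∫ x, (x : ℝ) ∂(P : Measure ℝ≥0) ≤ ν / δ + δ / (1 - δ) := by
  set μ := (P : Measure ℝ≥0)
  have hδ2 : 0 < 1 - δ := by linarith
  have iδ : IntegrableOn (fun y : ℝ => Real.exp (-((1 - δ) * y))) (Ici 0) := by
    have := (integrableOn_exp_mul_pow (inv_pos.2 hδ2) 0).const_mul (1 - δ)⁻¹
    refine this.congr (ae_of_all _ fun y => ?_)
    simp only [div_inv_eq_mul, pow_zero, mul_one, one_mul]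
    rw [mul_comm y, inv_mul_cancel_left₀ hδ2.ne']
  have eδ : ∫ y in Ici (0 : ℝ), Real.exp (-((1 - δ) * y)) = 1 / (1 - δ) := by
    have := integral_exp_mul_pow (inv_pos.2 hδ2) 0
    simp only [div_inv_eq_mul, pow_zero, mul_one, integral_const_mul,
      Nat.factorial_zero, Nat.cast_one] at this
    simp only [mul_comm _ (1 - δ)] at this
    field_simp
    linarith
  have i0 : IntegrableOn (fun y : ℝ => Real.exp (-y)) (Ici 0) := by
    simpa only [← rayleighPDF_one_zero] using integrableOn_rayleighPDF 1 0
  have e0 : ∫ y in Ici (0 : ℝ), Real.exp (-y) = 1 := by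
    simp only [← rayleighPDF_one_zero, integral_rayleighPDF]
  -- Compare the output density with the slower exponential exp(-(1-δ)y) in place of exp(-y). The
  -- inequality f log f + (1-δ)yf + exp(-(1-δ)y) - f ≥ 0 leaves a spare δyf on the other side.
  have hpt : ∀ y ∈ Ici (0 : ℝ), ENNReal.ofReal δ * ENNReal.ofReal (outPDF 1 μ y * y) ≤
      ENNReal.ofReal (outPDF 1 μ y * Real.log (outPDF 1 μ y) + outPDF 1 μ y * y + Real.exp (-y)
        - outPDF 1 μ y) + ENNReal.ofReal (Real.exp (-((1 - δ) * y)) - Real.exp (-y)) := by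
    intro y hy
    have hy0 : 0 ≤ y := hy
    have h1 := mul_log_sub_nonneg (outPDF_pos (θ := 1) (μ := μ) hy)
      (Real.exp_pos (-((1 - δ) * y)))
    rw [Real.log_exp] at h1
    have h2 : Real.exp (-y) ≤ Real.exp (-((1 - δ) * y)) := by
      apply Real.exp_le_exp.2; nlinarith
    rw [← ENNReal.ofReal_mul hδ.le, ← ENNReal.ofReal_add (cost_integrand_nonneg hy) (by linarith)]
    exact ENNReal.ofReal_le_ofReal (by linarith)
  have i1 : IntegrableOn (fun y : ℝ => Real.exp (-((1 - δ) * y)) - Real.exp (-y)) (Ici 0) :=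
    iδ.sub i0
  have hpm : Measurable fun y => ENNReal.ofReal (outPDF 1 μ y * y) :=
    (measurable_outPDF.mul measurable_id).ennreal_ofReal
  have hm2 : Measurable fun y : ℝ =>
      ENNReal.ofReal (Real.exp (-((1 - δ) * y)) - Real.exp (-y)) := by fun_prop
  have h3 := setLIntegral_mono' (μ := volume) measurableSet_Ici hpt
  rw [lintegral_add_right _ hm2, lintegral_const_mul _ hpm, lintegral_outPDF_mul_self,
    ← wardenDivergence_eq_lintegral, ← ofReal_integral_eq_lintegral_ofReal i1,
    integral_sub iδ i0, eδ, e0] at h3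
  · have h4 : ENNReal.ofReal δ * ∫⁻ x, ENNReal.ofReal (outScale 1 x) ∂μ ≤
        ENNReal.ofReal (ν + (1 / (1 - δ) - 1)) := by
      refine h3.trans ?_
      rw [ENNReal.ofReal_add hν]
      · exact add_le_add hP le_rfl
      · rw [sub_nonneg, le_div_iff₀ hδ2]; linarith
    have h5 : ∫⁻ x, ENNReal.ofReal (outScale 1 x) ∂μ ≠ ∞ := by
      intro h
      rw [h, ENNReal.mul_top (by simpa using hδ)] at h4
      simp at h4
    have h6 : Integrable (outScale 1) μ :=
      (lintegral_ofReal_ne_top_iff_integrable (continuous_outScale 1).aestronglyMeasurable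
        (ae_of_all _ fun x => (outScale_pos 1 x).le)).1 h5
    have h7 : FiniteMean μ := by
      refine (h6.sub (integrable_const (1 : ℝ))).congr (ae_of_all _ fun x => ?_)
      simp [outScale]
    refine ⟨h7, ?_⟩
    rw [← ofReal_integral_eq_lintegral_ofReal h6 (ae_of_all _ fun x => (outScale_pos 1 x).le),
      ← ENNReal.ofReal_mul hδ.le, h7.integral_outScale, ENNReal.ofReal_le_ofReal_iff] at h4
    · have h8 : 1 / (1 - δ) - 1 = δ * (1 / (1 - δ)) := by field_simp; ring
      have h9 : (∫ x, (x : ℝ) ∂μ) + 1 ≤ ν / δ + 1 / (1 - δ) := by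
        have : δ * ((∫ x, (x : ℝ) ∂μ) + 1) ≤ δ * (ν / δ + 1 / (1 - δ)) := by
          rw [mul_add δ (ν / δ), ← h8, mul_div_cancel₀ _ hδ.ne']
          linarith
        exact le_of_mul_le_mul_left this hδ
      have h10 : δ / (1 - δ) = 1 / (1 - δ) - 1 := by field_simp; ring
      linarith
    · have : 1 ≤ 1 / (1 - δ) := by rw [le_div_iff₀ hδ2]; linarith
      linarith
  · filter_upwards [ae_restrict_mem measurableSet_Ici] with y hy
    have hy0 : 0 ≤ y := hy
    have : Real.exp (-y) ≤ Real.exp (-((1 - δ) * y)) := by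
      apply Real.exp_le_exp.2; nlinarith
    simpa using this

theorem finiteMean_of_mem_covertInputs {ν : ℝ} (hν : 0 ≤ ν) {P : ProbabilityMeasure ℝ≥0}
    (hP : P ∈ covertInputs ν) : FiniteMean (P : Measure ℝ≥0) :=
  (mean_bound_of_mem_covertInputs hν one_half_pos one_half_lt_one hP).1

theorem mem_covertInputs_iff {ν : ℝ} (hν : 0 ≤ ν) {P : ProbabilityMeasure ℝ≥0}
    (h : FiniteMean (P : Measure ℝ≥0)) :
    P ∈ covertInputs ν ↔ cost (P : Measure ℝ≥0) ≤ ν := by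
  change wardenDivergence P ≤ _ ↔ _
  rw [wardenDivergence_eq_ofReal_cost h, ENNReal.ofReal_le_ofReal_iff hν]

theorem finiteMean_dirac (x : ℝ≥0) : FiniteMean (Measure.dirac x) :=
  integrable_dirac (by simp)

theorem outPDF_dirac (θ : ℝ) (x : ℝ≥0) (y : ℝ) :
    outPDF θ (Measure.dirac x) y = rayleighPDF θ x y := by
  simp [outPDF]

theorem crossEnt_dirac_zero (θ : ℝ) (x : ℝ≥0) :
    crossEnt θ (Measure.dirac 0) x = outScale θ x := by
  have : ∀ y, -Real.log (outPDF θ (Measure.dirac 0) y) = y := by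
    intro y; rw [outPDF_dirac]; simp [rayleighPDF]
  simp only [crossEnt, this, integral_rayleighPDF_mul_self]

theorem cost_dirac_zero : cost (Measure.dirac 0) = 0 := by
  rw [cost, outEntropy_eq_integral_crossEnt (finiteMean_dirac 0)]
  simp [crossEnt_dirac_zero, outScale]

/-- Gibbs' inequality against the output of the zero input, whose cross entropy at x is exactly the
output mean. -/
theorem rate_le_mul_mean [IsProbabilityMeasure μ] (h : FiniteMean μ) :
    rate θ μ ≤ θ ^ 2 * ∫ x, (x : ℝ) ∂μ := by
  have h1 := outEntropy_le_integral_crossEnt (θ := θ) h (finiteMean_dirac 0)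
  simp only [crossEnt_dirac_zero, h.integral_outScale] at h1
  have h3 : 0 ≤ ∫ x, Real.log (outScale θ x) ∂μ :=
    integral_nonneg fun x => Real.log_nonneg (one_le_outScale θ x)
  rw [rate]
  linarith

end OutputLaw

/-! ### Mixtures of input laws -/

/-- The mixture `(1 - ε) μ + ε μ'`. -/
noncomputable def mix (ε : ℝ) (μ μ' : Measure ℝ≥0) : Measure ℝ≥0 :=
  ENNReal.ofReal (1 - ε) • μ + ENNReal.ofReal ε • μ'

section Mixture

variable {θ ε : ℝ} {μ μ' : Measure ℝ≥0} [IsProbabilityMeasure μ] [IsProbabilityMeasure μ']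

theorem isProbabilityMeasure_mix (h0 : 0 ≤ ε) (h1 : ε ≤ 1) :
    IsProbabilityMeasure (mix ε μ μ') := by
  refine ⟨?_⟩
  simp only [mix, Measure.coe_add, Measure.coe_smul, Pi.add_apply, Pi.smul_apply, measure_univ,
    smul_eq_mul, mul_one]
  rw [← ENNReal.ofReal_add (by linarith) h0]
  simp

omit [IsProbabilityMeasure μ] [IsProbabilityMeasure μ'] in
theorem integrable_mix {f : ℝ≥0 → ℝ} (h : Integrable f μ) (h' : Integrable f μ') :
    Integrable f (mix ε μ μ') :=
  (h.smul_measure ENNReal.ofReal_ne_top).add_measure (h'.smul_measure ENNReal.ofReal_ne_top)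

omit [IsProbabilityMeasure μ] [IsProbabilityMeasure μ'] in
theorem integral_mix (h0 : 0 ≤ ε) (h1 : ε ≤ 1) {f : ℝ≥0 → ℝ} (h : Integrable f μ)
    (h' : Integrable f μ') :
    ∫ x, f x ∂(mix ε μ μ') = (1 - ε) * ∫ x, f x ∂μ + ε * ∫ x, f x ∂μ' := by
  rw [mix, integral_add_measure (h.smul_measure ENNReal.ofReal_ne_top)
    (h'.smul_measure ENNReal.ofReal_ne_top), integral_smul_measure, integral_smul_measure,
    ENNReal.toReal_ofReal h0, ENNReal.toReal_ofReal (by linarith), smul_eq_mul, smul_eq_mul]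

omit [IsProbabilityMeasure μ] [IsProbabilityMeasure μ'] in
theorem FiniteMean.mix (h : FiniteMean μ) (h' : FiniteMean μ') : FiniteMean (mix ε μ μ') :=
  integrable_mix h h'

theorem outPDF_mix (h0 : 0 ≤ ε) (h1 : ε ≤ 1) {y : ℝ} (hy : 0 ≤ y) :
    outPDF θ (mix ε μ μ') y = (1 - ε) * outPDF θ μ y + ε * outPDF θ μ' y :=
  integral_mix h0 h1 (integrable_rayleighPDF_left hy) (integrable_rayleighPDF_left hy)

/-- The mixture's entropy is its cross entropy averaged over both components. Gibbs is applied to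
the μ part only; keeping the μ' part exact preserves the directional derivative as ε → 0. -/
theorem le_outEntropy_mix (h0 : 0 ≤ ε) (h1 : ε ≤ 1) (h : FiniteMean μ) (h' : FiniteMean μ') :
    (1 - ε) * outEntropy θ μ + ε * ∫ x, crossEnt θ (mix ε μ μ') x ∂μ' ≤
      outEntropy θ (mix ε μ μ') := by
  have := isProbabilityMeasure_mix (μ := μ) (μ' := μ') h0 h1
  rw [outEntropy_eq_integral_crossEnt (μ := RayleighCovert.mix ε μ μ') (h.mix h'),
    integral_mix h0 h1 (integrable_crossEnt h) (integrable_crossEnt h')]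
  have := outEntropy_le_integral_crossEnt (θ := θ) h (h.mix h' (ε := ε))
  have h2 : 0 ≤ 1 - ε := by linarith
  gcongr

theorem le_rate_mix (h0 : 0 ≤ ε) (h1 : ε ≤ 1) (h : FiniteMean μ) (h' : FiniteMean μ') :
    (1 - ε) * rate θ μ + ε * (∫ x, crossEnt θ (mix ε μ μ') x ∂μ' - 1
      - ∫ x, Real.log (outScale θ x) ∂μ') ≤ rate θ (mix ε μ μ') := by
  have := le_outEntropy_mix (θ := θ) h0 h1 h h'
  rw [rate, rate, integral_mix h0 h1 (integrable_log_outScale h) (integrable_log_outScale h')]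
  linarith

theorem cost_mix_le (h0 : 0 ≤ ε) (h1 : ε ≤ 1) (h : FiniteMean μ) (h' : FiniteMean μ') :
    cost (mix ε μ μ') ≤ (1 - ε) * cost μ + ε * (∫ x, (x : ℝ) ∂μ' + 1
      - ∫ x, crossEnt 1 (mix ε μ μ') x ∂μ') := by
  have := le_outEntropy_mix (θ := 1) h0 h1 h h'
  rw [cost, cost, integral_mix h0 h1 h h']
  linarith

theorem rate_mix_concave (h0 : 0 ≤ ε) (h1 : ε ≤ 1) (h : FiniteMean μ) (h' : FiniteMean μ') :
    (1 - ε) * rate θ μ + ε * rate θ μ' ≤ rate θ (mix ε μ μ') := by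
  refine le_trans ?_ (le_rate_mix h0 h1 h h')
  have := isProbabilityMeasure_mix (μ := μ) (μ' := μ') h0 h1
  have := outEntropy_le_integral_crossEnt (θ := θ) h' (h.mix h' (ε := ε))
  rw [rate, rate]
  gcongr

theorem cost_mix_convex (h0 : 0 ≤ ε) (h1 : ε ≤ 1) (h : FiniteMean μ) (h' : FiniteMean μ') :
    cost (mix ε μ μ') ≤ (1 - ε) * cost μ + ε * cost μ' := by
  refine (cost_mix_le h0 h1 h h').trans ?_
  have := isProbabilityMeasure_mix (μ := μ) (μ' := μ') h0 h1
  have := outEntropy_le_integral_crossEnt (θ := 1) h' (h.mix h' (ε := ε))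
  rw [cost, cost]
  gcongr

/-- Dominated convergence: for ε < 1/2 the mixed density is at least half that of μ, so its -log
exceeds that of μ by at most log 2. -/
theorem tendsto_crossEnt_mix {η : ℝ} (x : ℝ≥0) :
    Tendsto (fun ε => crossEnt η (mix ε μ μ') x) (𝓝[>] 0) (𝓝 (crossEnt η μ x)) := by
  have hε : ∀ᶠ ε in 𝓝[>] (0 : ℝ), 0 < ε ∧ ε < 1 / 2 :=
    Ioo_mem_nhdsGT (by norm_num : (0 : ℝ) < 1 / 2)
  refine tendsto_integral_filter_of_dominated_convergence
    (fun y => rayleighPDF η x y * Real.log 2 + rayleighPDF η x y * -Real.log (outPDF η μ y))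
    ?_ ?_ ?_ ?_
  · filter_upwards [hε] with ε hε
    have := isProbabilityMeasure_mix (μ := μ) (μ' := μ') hε.1.le (by linarith [hε.2] : ε ≤ 1)
    exact ((continuous_rayleighPDF_right η x).measurable.mul
      measurable_log_outPDF.neg).aestronglyMeasurable
  · filter_upwards [hε] with ε hε
    have := isProbabilityMeasure_mix (μ := μ) (μ' := μ') hε.1.le (by linarith [hε.2] : ε ≤ 1)
    filter_upwards [ae_restrict_mem measurableSet_Ici] with y hy
    have hp := rayleighPDF_pos η x y
    have h1 := neg_log_outPDF_nonneg (θ := η) (μ := mix ε μ μ') hy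
    have h2 := outPDF_pos (θ := η) (μ := μ) hy
    have h3 := outPDF_pos (θ := η) (μ := μ') hy
    rw [Real.norm_of_nonneg (mul_nonneg hp.le h1), ← mul_add]
    refine mul_le_mul_of_nonneg_left ?_ hp.le
    have h4 : outPDF η μ y / 2 ≤ outPDF η (mix ε μ μ') y := by
      rw [outPDF_mix hε.1.le (by linarith [hε.2]) hy]
      nlinarith [mul_pos hε.1 h3, hε.2]
    have h5 := Real.log_le_log (by positivity) h4
    rw [Real.log_div h2.ne' two_ne_zero] at h5
    linarith
  · exact ((integrableOn_rayleighPDF η x).mul_const _).add (integrableOn_crossEnt x)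
  · filter_upwards [ae_restrict_mem measurableSet_Ici] with y hy
    have h2 := outPDF_pos (θ := η) (μ := μ) hy
    refine Tendsto.const_mul _ (Tendsto.neg ((Real.continuousAt_log h2.ne').tendsto.comp ?_))
    have h6 : Tendsto (fun ε : ℝ => (1 - ε) * outPDF η μ y + ε * outPDF η μ' y) (𝓝[>] 0)
        (𝓝 ((1 - 0) * outPDF η μ y + 0 * outPDF η μ' y)) := by
      refine Tendsto.mono_left (Continuous.tendsto ?_ 0) nhdsWithin_le_nhds
      fun_prop
    rw [sub_zero, one_mul, zero_mul, add_zero] at h6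
    refine h6.congr' ?_
    filter_upwards [hε] with ε hε
    rw [outPDF_mix hε.1.le (by linarith [hε.2]) hy]

end Mixture

/-! ### Lagrange multiplier and the optimality conditions -/

/-- A Lagrange multiplier exists when the constraint is active for the rate. -/
theorem exists_lagrange_multiplier {θ ν : ℝ} (hν : 0 < ν) {μ : Measure ℝ≥0}
    (hc : cost μ ≤ ν)
    (hopt : ∀ μ' : Measure ℝ≥0, IsProbabilityMeasure μ' → FiniteMean μ' → cost μ' ≤ ν →
      rate θ μ' ≤ rate θ μ)
    (hslater : ∃ μ' : Measure ℝ≥0, IsProbabilityMeasure μ' ∧ FiniteMean μ' ∧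
      rate θ μ < rate θ μ') :
    ∃ l : ℝ, 0 < l ∧ ∀ μ' : Measure ℝ≥0, IsProbabilityMeasure μ' → FiniteMean μ' →
      rate θ μ' - l * cost μ' ≤ rate θ μ - l * cost μ := by
  -- The mixture weight ε interpolates the costs to exactly ν, so the mixture is feasible.
  -- Optimality then says that each chord slope right of ν is at most each chord slope left of ν.
  have key : ∀ μ₀ μ₁ : Measure ℝ≥0, IsProbabilityMeasure μ₀ → FiniteMean μ₀ →
      IsProbabilityMeasure μ₁ → FiniteMean μ₁ → cost μ₀ < ν → ν < cost μ₁ →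
      (rate θ μ₁ - rate θ μ) / (cost μ₁ - ν) ≤ (rate θ μ - rate θ μ₀) / (ν - cost μ₀) := by
    intro μ₀ μ₁ p0 f0 p1 f1 c0 c1
    have hd : 0 < cost μ₁ - cost μ₀ := by linarith
    set ε := (ν - cost μ₀) / (cost μ₁ - cost μ₀) with hε
    have he0 : 0 ≤ ε := div_nonneg (by linarith) hd.le
    have he1 : ε ≤ 1 := (div_le_one hd).2 (by linarith)
    have heq : ε * (cost μ₁ - cost μ₀) = ν - cost μ₀ := div_mul_cancel₀ _ hd.ne'
    have h1 := cost_mix_convex he0 he1 f0 f1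
    have h2 := rate_mix_concave (θ := θ) he0 he1 f0 f1
    have h3 := hopt _ (isProbabilityMeasure_mix he0 he1) (f0.mix f1) (h1.trans (by linarith))
    have h4 : (1 - ε) * rate θ μ₀ + ε * rate θ μ₁ ≤ rate θ μ := h2.trans h3
    have h5 := mul_le_mul_of_nonneg_right h4 hd.le
    have h6 : ((1 - ε) * rate θ μ₀ + ε * rate θ μ₁) * (cost μ₁ - cost μ₀) =
        (cost μ₁ - ν) * rate θ μ₀ + (ν - cost μ₀) * rate θ μ₁ := by
      linear_combination (rate θ μ₁ - rate θ μ₀) * heq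
    rw [div_le_div_iff₀ (by linarith) (by linarith)]
    rw [h6] at h5
    linarith
  -- The multiplier is the supremum of the right slopes: left slopes bound it above, and the input
  -- with larger rate, necessarily infeasible, makes it positive.
  set S : Set ℝ := {k | ∃ μ' : Measure ℝ≥0, IsProbabilityMeasure μ' ∧ FiniteMean μ' ∧
    ν < cost μ' ∧ k = (rate θ μ' - rate θ μ) / (cost μ' - ν)} with hS
  have hbdd : ∀ μ₀ : Measure ℝ≥0, IsProbabilityMeasure μ₀ → FiniteMean μ₀ → cost μ₀ < ν →
      ∀ k ∈ S, k ≤ (rate θ μ - rate θ μ₀) / (ν - cost μ₀) := by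
    rintro μ₀ p0 f0 c0 k ⟨μ₁, p1, f1, c1, rfl⟩
    exact key μ₀ μ₁ p0 f0 p1 f1 c0 c1
  have hba : BddAbove S := ⟨_, fun k hk => hbdd (Measure.dirac 0) inferInstance
    (finiteMean_dirac 0) (by rw [cost_dirac_zero]; exact hν) k hk⟩
  obtain ⟨μ₁, p1, f1, r1⟩ := hslater
  have c1 : ν < cost μ₁ := by
    by_contra! h
    exact absurd (hopt μ₁ p1 f1 h) (not_le.2 r1)
  have hne : S.Nonempty := ⟨_, μ₁, p1, f1, c1, rfl⟩
  have hl : 0 < sSup S :=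
    (div_pos (by linarith) (by linarith)).trans_le (le_csSup hba ⟨μ₁, p1, f1, c1, rfl⟩)
  refine ⟨sSup S, hl, fun μ' p' f' => ?_⟩
  have hmain : rate θ μ' - rate θ μ ≤ sSup S * (cost μ' - ν) := by
    rcases lt_trichotomy (cost μ') ν with h | h | h
    · have := csSup_le hne (hbdd μ' p' f' h)
      rw [le_div_iff₀ (by linarith)] at this
      linarith
    · rw [h]
      have := hopt μ' p' f' h.le
      linarith
    · have := le_csSup hba ⟨μ', p', f', h, rfl⟩
      rw [div_le_iff₀ (by linarith)] at this
      linarith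
  have := mul_le_mul_of_nonneg_left hc hl.le
  linarith

/-- The Lagrangian density at the input `x`, for multiplier `l`. -/
noncomputable def lagrangian (θ l : ℝ) (μ : Measure ℝ≥0) (x : ℝ≥0) : ℝ :=
  crossEnt θ μ x - 1 - Real.log (outScale θ x) - l * (outScale 1 x - crossEnt 1 μ x)

section Optimality

variable {θ l : ℝ} {μ : Measure ℝ≥0} [IsProbabilityMeasure μ]

theorem integral_lagrangian (h : FiniteMean μ) :
    Integrable (lagrangian θ l μ) μ ∧ ∫ x, lagrangian θ l μ x ∂μ = rate θ μ - l * cost μ := by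
  have i1 := integral_crossEnt_sub (θ := θ) (μ' := μ) h
  have i2 : Integrable (fun x => l * (outScale 1 x - crossEnt 1 μ x)) μ :=
    ((h.integrable_outScale (θ := 1)).sub (integrable_crossEnt h)).const_mul l
  refine ⟨i1.1.sub i2, ?_⟩
  simp only [lagrangian]
  rw [integral_sub i1.1 i2, integral_crossEnt_sub_eq_rate h, integral_const_mul,
    integral_sub (h.integrable_outScale (θ := 1)) (integrable_crossEnt h), h.integral_outScale,
    ← outEntropy_eq_integral_crossEnt h, cost]
  ring

/-- First-order condition: perturb towards the point mass at x, cancel ε, and let ε → 0. -/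
theorem lagrangian_le (hl : 0 < l) (h : FiniteMean μ)
    (hopt : ∀ μ' : Measure ℝ≥0, IsProbabilityMeasure μ' → FiniteMean μ' →
      rate θ μ' - l * cost μ' ≤ rate θ μ - l * cost μ) (x : ℝ≥0) :
    lagrangian θ l μ x ≤ rate θ μ - l * cost μ := by
  have ht : Tendsto (fun ε => crossEnt θ (mix ε μ (Measure.dirac x)) x - 1
      - Real.log (outScale θ x) - l * (outScale 1 x - crossEnt 1 (mix ε μ (Measure.dirac x)) x))
      (𝓝[>] 0) (𝓝 (lagrangian θ l μ x)) :=
    (((tendsto_crossEnt_mix x).sub_const _).sub_const _).sub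
      ((tendsto_const_nhds.sub (tendsto_crossEnt_mix x)).const_mul l)
  refine le_of_tendsto ht ?_
  filter_upwards [Ioo_mem_nhdsGT (by norm_num : (0 : ℝ) < 1)] with ε hε
  have h1 := le_rate_mix (θ := θ) hε.1.le hε.2.le h (finiteMean_dirac x)
  have h2 := cost_mix_le hε.1.le hε.2.le h (finiteMean_dirac x)
  have h3 := hopt _ (isProbabilityMeasure_mix hε.1.le hε.2.le) (h.mix (finiteMean_dirac x) (ε := ε))
  rw [integral_dirac, integral_dirac] at h1 h2
  have h4 := mul_le_mul_of_nonneg_left h2 hl.le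
  have h5 : outScale 1 x = x + 1 := by simp [outScale]
  rw [h5]
  refine le_of_mul_le_mul_left ?_ hε.1
  linarith

/-- The μ-average of the Lagrangian density equals its upper bound, so the nonnegative deficit
integrates to zero. -/
theorem lagrangian_ae_eq (hl : 0 < l) (h : FiniteMean μ)
    (hopt : ∀ μ' : Measure ℝ≥0, IsProbabilityMeasure μ' → FiniteMean μ' →
      rate θ μ' - l * cost μ' ≤ rate θ μ - l * cost μ) :
    ∀ᵐ x ∂μ, lagrangian θ l μ x = rate θ μ - l * cost μ := by
  obtain ⟨i, e⟩ := integral_lagrangian (θ := θ) (l := l) h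
  have h0 : ∫ x, (rate θ μ - l * cost μ - lagrangian θ l μ x) ∂μ = 0 := by
    rw [integral_sub (integrable_const _) i, e]; simp
  have h1 := (integral_eq_zero_iff_of_nonneg
    (fun x => sub_nonneg.2 (lagrangian_le hl h hopt x)) ((integrable_const _).sub i)).1 h0
  filter_upwards [h1] with x hx
  have : rate θ μ - l * cost μ - lagrangian θ l μ x = 0 := hx
  linarith

end Optimality

/-! ### Measures determined by the moments of a bounded injective function -/

/-- Polynomials in φ form an algebra of bounded continuous functions separating points, and such an
algebra determines a finite measure on a Polish space. -/
theorem measure_ext_of_integral_pow {E : Type*} [TopologicalSpace E] [PolishSpace E]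
    [MeasurableSpace E] [BorelSpace E] {P P' : Measure E} [IsFiniteMeasure P] [IsFiniteMeasure P']
    {φ : E → ℝ} (hφ : Continuous φ) (hinj : Function.Injective φ) {C : ℝ} (hb : ∀ x, ‖φ x‖ ≤ C)
    (h : ∀ n : ℕ, ∫ x, φ x ^ n ∂P = ∫ x, φ x ^ n ∂P') : P = P' := by
  let Φ : BoundedContinuousFunction E ℝ := BoundedContinuousFunction.ofNormedAddCommGroup φ hφ C hb
  have hΦ : ∀ x, Φ x = φ x := fun x => rfl
  let A : StarSubalgebra ℝ (BoundedContinuousFunction E ℝ) :=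
    { Algebra.adjoin ℝ {Φ} with
      star_mem' := fun {a} ha => by
        have : star a = a := by ext x; simp
        rw [this]; exact ha }
  have hΦA : Φ ∈ A := Algebra.subset_adjoin rfl
  refine ext_of_forall_mem_subalgebra_integral_eq_of_polish (𝕜 := ℝ) (A := A) ?_ ?_
  · intro x y hxy
    refine ⟨Φ, ⟨BoundedContinuousFunction.toContinuousMapStarₐ ℝ Φ, ⟨Φ, hΦA, rfl⟩, rfl⟩, ?_⟩
    exact fun e => hxy (hinj e)
  · intro g hg
    have hg' : g ∈ Algebra.adjoin ℝ {Φ} := hg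
    rw [Algebra.adjoin_singleton_eq_range_aeval] at hg'
    obtain ⟨p, rfl⟩ := hg'
    change ∫ x, (Polynomial.aeval Φ p) x ∂P = ∫ x, (Polynomial.aeval Φ p) x ∂P'
    have hval : ∀ x, (Polynomial.aeval Φ p) x =
        ∑ i ∈ Finset.range (p.natDegree + 1), p.coeff i * φ x ^ i := by
      intro x
      rw [Polynomial.aeval_eq_sum_range, BoundedContinuousFunction.coe_sum, Finset.sum_apply]
      simp [hΦ]
    simp only [hval]
    have hi : ∀ (Q : Measure E) [IsFiniteMeasure Q] (i : ℕ),
        Integrable (fun x => p.coeff i * φ x ^ i) Q := by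
      intro Q _ i
      refine Integrable.const_mul ?_ _
      refine (integrable_const (C ^ i)).mono' (hφ.pow i).aestronglyMeasurable (ae_of_all _ fun x => ?_)
      rw [norm_pow]
      exact pow_le_pow_left₀ (norm_nonneg _) (hb x) i
    rw [integral_finsetSum _ fun i _ => hi P i, integral_finsetSum _ fun i _ => hi P' i]
    simp only [integral_const_mul, h]

section Injectivity

variable {θ : ℝ} {μ μ' : Measure ℝ≥0}

/-- The input law weighted by the inverse output mean. -/
noncomputable def weighted (θ : ℝ) (μ : Measure ℝ≥0) : Measure ℝ≥0 :=
  μ.withDensity fun x => ENNReal.ofReal (1 / outScale θ x)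

theorem continuous_one_div_outScale (θ : ℝ) : Continuous fun x => 1 / outScale θ x := by
  have h : ∀ x, outScale θ x ≠ 0 := fun x => (outScale_pos θ x).ne'
  fun_prop (disch := exact h)

theorem one_div_outScale_le_one (x : ℝ≥0) : 1 / outScale θ x ≤ 1 :=
  (div_le_one (outScale_pos θ x)).2 (one_le_outScale θ x)

instance isFiniteMeasure_weighted [IsFiniteMeasure μ] : IsFiniteMeasure (weighted θ μ) := by
  refine isFiniteMeasure_withDensity_ofReal (Integrable.hasFiniteIntegral ?_)
  refine (integrable_const (1 : ℝ)).mono' (continuous_one_div_outScale θ).aestronglyMeasurable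
    (ae_of_all _ fun x => ?_)
  have := outScale_pos θ x
  rw [Real.norm_of_nonneg (by positivity)]
  exact one_div_outScale_le_one x

theorem integral_weighted (f : ℝ≥0 → ℝ) :
    ∫ x, f x ∂(weighted θ μ) = ∫ x, 1 / outScale θ x * f x ∂μ := by
  rw [weighted, integral_withDensity_eq_integral_toReal_smul
    (continuous_one_div_outScale θ).measurable.ennreal_ofReal (ae_of_all _ fun _ => by simp)]
  refine integral_congr_ae (ae_of_all _ fun x => ?_)
  have := outScale_pos θ x
  simp only [smul_eq_mul]
  rw [ENNReal.toReal_ofReal (by positivity)]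

theorem outPDF_eq_integral_weighted (y : ℝ) :
    outPDF θ μ y = ∫ x, Real.exp (-(y / outScale θ x)) ∂(weighted θ μ) := by
  rw [integral_weighted]; rfl

theorem weighted_injective [IsFiniteMeasure μ] [IsFiniteMeasure μ']
    (h : weighted θ μ = weighted θ μ') : μ = μ' := by
  have hm : Measurable fun x => ENNReal.ofReal (1 / outScale θ x) :=
    (continuous_one_div_outScale θ).measurable.ennreal_ofReal
  have key : ∀ ρ : Measure ℝ≥0, (weighted θ ρ).withDensity
      (fun x => ENNReal.ofReal (1 / outScale θ x))⁻¹ = ρ := fun ρ =>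
    withDensity_inv_same hm
      (ae_of_all _ fun x => by simpa using outScale_pos θ x) (ae_of_all _ fun _ => by simp)
  rw [← key μ, h, key μ']

/-- At y = n the density is the n-th moment of exp(-1/s) under the weighted input law, and x ↦
exp(-1/s) is bounded and injective. -/
theorem outPDF_injective (hθ : θ ≠ 0) [IsFiniteMeasure μ] [IsFiniteMeasure μ']
    (h : ∀ n : ℕ, outPDF θ μ n = outPDF θ μ' n) : μ = μ' := by
  refine weighted_injective (θ := θ) (measure_ext_of_integral_pow
    (φ := fun x => Real.exp (-(1 / outScale θ x))) (C := 1) ?_ ?_ ?_ ?_)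
  · exact Real.continuous_exp.comp (continuous_one_div_outScale θ).neg
  · intro a b hab
    have h1 := Real.exp_injective hab
    have h2 : outScale θ a = outScale θ b := by
      have h3 := neg_injective h1
      rwa [one_div, one_div, inv_inj] at h3
    have h3 : θ ^ 2 * (a : ℝ) = θ ^ 2 * b := by
      unfold outScale at h2; linarith
    exact_mod_cast mul_left_cancel₀ (pow_ne_zero 2 hθ) h3
  · intro x
    rw [Real.norm_of_nonneg (Real.exp_pos _).le, Real.exp_le_one_iff]
    have := outScale_pos θ x
    have : 0 ≤ 1 / outScale θ x := by positivity
    linarith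
  · intro n
    have e : ∀ x, Real.exp (-(1 / outScale θ x)) ^ n = Real.exp (-((n : ℝ) / outScale θ x)) := by
      intro x
      rw [← Real.exp_nat_mul]
      congr 1
      ring
    simp only [e, ← outPDF_eq_integral_weighted, h]

theorem continuousOn_outPDF [IsFiniteMeasure μ] : ContinuousOn (outPDF θ μ) (Ici 0) := by
  refine continuousOn_of_dominated (bound := fun _ => 1) ?_ ?_ (integrable_const _) ?_
  · exact fun y _ => (continuous_rayleighPDF_left θ y).aestronglyMeasurable
  · intro y hy
    refine ae_of_all _ fun x => ?_
    rw [Real.norm_of_nonneg (rayleighPDF_pos θ x y).le]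
    exact rayleighPDF_le_one θ x hy
  · exact ae_of_all _ fun x => (continuous_rayleighPDF_right θ x).continuousOn

/-- Equality in the concavity of the output entropy forces equality of the input laws. -/
theorem eq_of_outEntropy_mix_le (hθ : θ ≠ 0) [IsProbabilityMeasure μ] [IsProbabilityMeasure μ']
    (h : FiniteMean μ) (h' : FiniteMean μ')
    (hle : outEntropy θ (mix (1 / 2) μ μ') ≤ (outEntropy θ μ + outEntropy θ μ') / 2) :
    μ = μ' := by
  have : IsProbabilityMeasure (mix (1 / 2) μ μ') :=
    isProbabilityMeasure_mix (by norm_num) (by norm_num)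
  have i1 := (integrableOn_negMulLog_outPDF (θ := θ) h).div_const 2
  have i2 := (integrableOn_negMulLog_outPDF (θ := θ) h').div_const 2
  have i3 := integrableOn_negMulLog_outPDF (θ := θ) (h.mix h' (ε := 1 / 2))
  have hmid : ∀ y, 0 ≤ y → outPDF θ (mix (1 / 2) μ μ') y =
      (1 / 2) * outPDF θ μ y + (1 / 2) * outPDF θ μ' y := by
    intro y hy
    rw [outPDF_mix (by norm_num) (by norm_num) hy]
    norm_num
  have hnn : 0 ≤ᵐ[volume.restrict (Ici (0 : ℝ))] fun y =>
      Real.negMulLog (outPDF θ (mix (1 / 2) μ μ') y) -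
        (Real.negMulLog (outPDF θ μ y) / 2 + Real.negMulLog (outPDF θ μ' y) / 2) := by
    filter_upwards [ae_restrict_mem measurableSet_Ici] with y hy
    have := Real.concaveOn_negMulLog.2 (mem_Ici.2 (outPDF_nonneg (θ := θ) (μ := μ) y))
      (mem_Ici.2 (outPDF_nonneg (θ := θ) (μ := μ') y)) (by norm_num : (0 : ℝ) ≤ 1 / 2)
      (by norm_num : (0 : ℝ) ≤ 1 / 2) (by norm_num)
    simp only [smul_eq_mul, ← hmid y hy] at this
    simp only [Pi.zero_apply]
    linarith
  have i4 : Integrable (fun y => Real.negMulLog (outPDF θ μ y) / 2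
      + Real.negMulLog (outPDF θ μ' y) / 2) (volume.restrict (Ici (0 : ℝ))) := i1.add i2
  have h0 : ∫ y in Ici (0 : ℝ), (Real.negMulLog (outPDF θ (mix (1 / 2) μ μ') y) -
        (Real.negMulLog (outPDF θ μ y) / 2 + Real.negMulLog (outPDF θ μ' y) / 2)) = 0 := by
    refine le_antisymm ?_ (integral_nonneg_of_ae hnn)
    rw [integral_sub i3 i4, integral_add i1 i2, integral_div, integral_div]
    simp only [outEntropy] at hle
    linarith
  have hae := (integral_eq_zero_iff_of_nonneg_ae hnn (i3.sub i4)).1 h0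
  have hae' : outPDF θ μ =ᵐ[volume.restrict (Ici (0 : ℝ))] outPDF θ μ' := by
    filter_upwards [hae, ae_restrict_mem measurableSet_Ici] with y hy hy0
    by_contra hne
    have := Real.strictConcaveOn_negMulLog.2 (mem_Ici.2 (outPDF_nonneg (θ := θ) (μ := μ) y))
      (mem_Ici.2 (outPDF_nonneg (θ := θ) (μ := μ') y)) hne (by norm_num : (0 : ℝ) < 1 / 2)
      (by norm_num : (0 : ℝ) < 1 / 2) (by norm_num)
    simp only [smul_eq_mul, ← hmid y hy0] at this
    simp only [Pi.zero_apply] at hy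
    linarith
  have heq := Measure.eqOn_of_ae_eq hae' continuousOn_outPDF continuousOn_outPDF (by simp)
  exact outPDF_injective hθ fun n => heq (mem_Ici.2 n.cast_nonneg)

end Injectivity

/-- The midpoint of two maximisers is feasible. Since `rate` differs from the entropy by a term
affine in the input law, optimality rules out strict concavity of the entropy between them. -/
theorem eq_of_rate_max {θ ν : ℝ} (hθ : θ ≠ 0) {μ μ' : Measure ℝ≥0} [IsProbabilityMeasure μ]
    [IsProbabilityMeasure μ'] (h : FiniteMean μ) (h' : FiniteMean μ') (hc : cost μ ≤ ν)
    (hc' : cost μ' ≤ ν)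
    (hopt : ∀ ρ : Measure ℝ≥0, IsProbabilityMeasure ρ → FiniteMean ρ → cost ρ ≤ ν →
      rate θ ρ ≤ rate θ μ) (heq : rate θ μ' = rate θ μ) : μ = μ' := by
  refine eq_of_outEntropy_mix_le hθ h h' ?_
  have h0 : (0 : ℝ) ≤ 1 / 2 := by norm_num
  have h1 : (1 / 2 : ℝ) ≤ 1 := by norm_num
  have h2 := hopt _ (isProbabilityMeasure_mix h0 h1) (h.mix h' (ε := 1 / 2))
    ((cost_mix_convex h0 h1 h h').trans (by linarith))
  simp only [rate] at h2 heq
  rw [integral_mix h0 h1 (integrable_log_outScale h) (integrable_log_outScale h')] at h2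
  linarith

/-! ### Existence of an optimal input -/

section Existence

variable {θ : ℝ}

/-- The exponent 3/4 turns the density tail (1+y)^(-2) into the integrable (1+y)^(-3/2). -/
theorem negMulLog_le_rpow {p : ℝ} (hp : 0 < p) : Real.negMulLog p ≤ 4 * p ^ (3 / 4 : ℝ) := by
  have hq : 0 < p ^ (-(1 / 4) : ℝ) := by positivity
  have h1 := Real.log_le_sub_one_of_pos hq
  rw [Real.log_rpow hp] at h1
  have h2 : -Real.log p ≤ 4 * p ^ (-(1 / 4) : ℝ) := by linarith
  rw [negMulLog_eq_mul_neg_log]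
  calc p * -Real.log p ≤ p * (4 * p ^ (-(1 / 4) : ℝ)) := mul_le_mul_of_nonneg_left h2 hp.le
    _ = 4 * (p ^ (1 : ℝ) * p ^ (-(1 / 4) : ℝ)) := by rw [Real.rpow_one]; ring
    _ = 4 * p ^ (3 / 4 : ℝ) := by rw [← Real.rpow_add hp]; norm_num

theorem norm_negMulLog_outPDF_le {μ : Measure ℝ≥0} [IsProbabilityMeasure μ] (h : FiniteMean μ)
    {M : ℝ} (hM : ∫ x, (x : ℝ) ∂μ ≤ M) {y : ℝ} (hy : 0 ≤ y) :
    ‖Real.negMulLog (outPDF θ μ y)‖ ≤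
      4 * (4 * (θ ^ 2 * M + 1)) ^ (3 / 4 : ℝ) * (1 + ‖y‖) ^ (-(3 / 2) : ℝ) := by
  have hp := outPDF_pos (θ := θ) (μ := μ) hy
  have hM0 : 0 ≤ M := (integral_nonneg fun x : ℝ≥0 => x.2).trans hM
  have h1 : outPDF θ μ y ≤ 4 * (θ ^ 2 * M + 1) / (1 + y) ^ 2 :=
    (outPDF_le_div_sq h hy).trans (by gcongr)
  rw [Real.norm_of_nonneg (Real.negMulLog_nonneg hp.le (outPDF_le_one hy)), Real.norm_of_nonneg hy]
  refine (negMulLog_le_rpow hp).trans ?_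
  rw [mul_assoc]
  refine mul_le_mul_of_nonneg_left ?_ (by norm_num)
  refine (Real.rpow_le_rpow hp.le h1 (by norm_num)).trans (le_of_eq ?_)
  rw [Real.div_rpow (by positivity) (by positivity), Real.rpow_neg (by positivity), div_eq_mul_inv]
  congr 2
  rw [← Real.rpow_natCast, ← Real.rpow_mul (by positivity)]
  norm_num

theorem tendsto_outPDF {P : ProbabilityMeasure ℝ≥0} {Q : ℕ → ProbabilityMeasure ℝ≥0}
    (hQ : Tendsto Q atTop (𝓝 P)) {y : ℝ} (hy : 0 ≤ y) :
    Tendsto (fun n => outPDF θ (Q n : Measure ℝ≥0) y) atTop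
      (𝓝 (outPDF θ (P : Measure ℝ≥0) y)) := by
  let f : BoundedContinuousFunction ℝ≥0 ℝ := BoundedContinuousFunction.ofNormedAddCommGroup
    (fun x => rayleighPDF θ x y) (continuous_rayleighPDF_left θ y) 1 fun x => by
      rw [Real.norm_of_nonneg (rayleighPDF_pos θ x y).le]
      exact rayleighPDF_le_one θ x hy
  exact ProbabilityMeasure.tendsto_iff_forall_integral_tendsto.1 hQ f

theorem tendsto_outEntropy {P : ProbabilityMeasure ℝ≥0} {Q : ℕ → ProbabilityMeasure ℝ≥0}
    (hQ : Tendsto Q atTop (𝓝 P)) {M : ℝ} (hf : ∀ n, FiniteMean (Q n : Measure ℝ≥0))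
    (hM : ∀ n, ∫ x, (x : ℝ) ∂(Q n : Measure ℝ≥0) ≤ M) :
    Tendsto (fun n => outEntropy θ (Q n : Measure ℝ≥0)) atTop
      (𝓝 (outEntropy θ (P : Measure ℝ≥0))) := by
  refine tendsto_integral_of_dominated_convergence
    (fun y => 4 * (4 * (θ ^ 2 * M + 1)) ^ (3 / 4 : ℝ) * (1 + ‖y‖) ^ (-(3 / 2) : ℝ)) ?_ ?_ ?_ ?_
  · exact fun n =>
      (Real.continuous_negMulLog.measurable.comp measurable_outPDF).aestronglyMeasurable
  · refine Integrable.const_mul ?_ _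
    exact (integrable_one_add_norm (by norm_num)).restrict
  · intro n
    filter_upwards [ae_restrict_mem measurableSet_Ici] with y hy
    exact norm_negMulLog_outPDF_le (hf n) (hM n) hy
  · filter_upwards [ae_restrict_mem measurableSet_Ici] with y hy
    exact (Real.continuous_negMulLog.tendsto _).comp (tendsto_outPDF hQ hy)

theorem isCompact_closure_covertInputs {ν : ℝ} (hν : 0 ≤ ν) :
    IsCompact (closure (covertInputs ν)) := by
  refine isCompact_closure_of_isTightMeasureSet ?_
  rw [isTightMeasureSet_iff_exists_isCompact_measure_compl_le]
  intro ε hε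
  -- The mean bound at δ = 1/2; tightness then follows from Markov's inequality.
  set M : ℝ := 2 * ν + 1 with hM
  have hM0 : 0 < M := by linarith
  obtain ⟨R, hR0, hR⟩ : ∃ R : ℝ≥0, 0 < R ∧ ENNReal.ofReal M / R ≤ ε := by
    rcases eq_or_ne ε ∞ with rfl | hε'
    · exact ⟨1, one_pos, le_top⟩
    · refine ⟨(ENNReal.ofReal M / ε).toNNReal, ?_, ?_⟩
      · refine ENNReal.toNNReal_pos ?_ ?_
        · exact (ENNReal.div_pos (by simpa using hM0) hε').ne'
        · exact ENNReal.div_ne_top ENNReal.ofReal_ne_top hε.ne'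
      · rw [ENNReal.coe_toNNReal (ENNReal.div_ne_top ENNReal.ofReal_ne_top hε.ne')]
        refine ENNReal.div_le_of_le_mul ?_
        rw [ENNReal.mul_div_cancel hε.ne' hε']
  refine ⟨Icc 0 R, isCompact_Icc, ?_⟩
  rintro _ ⟨P, hP, rfl⟩
  obtain ⟨hf, hm⟩ := mean_bound_of_mem_covertInputs hν one_half_pos one_half_lt_one hP
  have hm' : ∫ x, (x : ℝ) ∂(P : Measure ℝ≥0) ≤ M := hm.trans (by rw [hM]; norm_num; linarith)
  have h1 : ∫⁻ x : ℝ≥0, (x : ℝ≥0∞) ∂(P : Measure ℝ≥0) ≤ ENNReal.ofReal M := by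
    calc ∫⁻ x : ℝ≥0, (x : ℝ≥0∞) ∂(P : Measure ℝ≥0)
        = ∫⁻ x : ℝ≥0, ENNReal.ofReal (x : ℝ) ∂(P : Measure ℝ≥0) := by
          simp only [ENNReal.ofReal_coe_nnreal]
      _ = ENNReal.ofReal (∫ x, (x : ℝ) ∂(P : Measure ℝ≥0)) :=
          (ofReal_integral_eq_lintegral_ofReal hf (ae_of_all _ fun x : ℝ≥0 => x.2)).symm
      _ ≤ ENNReal.ofReal M := ENNReal.ofReal_le_ofReal hm'
  calc (P : Measure ℝ≥0) (Icc 0 R)ᶜ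
      ≤ (P : Measure ℝ≥0) {x : ℝ≥0 | (R : ℝ≥0∞) ≤ x} := by
        refine measure_mono fun x hx => ?_
        have : ¬ x ≤ R := fun h => hx ⟨bot_le, h⟩
        exact ENNReal.coe_le_coe.2 (not_le.1 this).le
    _ ≤ (∫⁻ x : ℝ≥0, (x : ℝ≥0∞) ∂(P : Measure ℝ≥0)) / R :=
        meas_ge_le_lintegral_div measurable_coe_nnreal_ennreal.aemeasurable
          (by simpa using hR0.ne') ENNReal.coe_ne_top
    _ ≤ ENNReal.ofReal M / R := by gcongr
    _ ≤ ε := hR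

/-- Lower semicontinuity of the divergence by Fatou, using the nonnegative form of the integrand. -/
theorem mem_covertInputs_of_tendsto {ν : ℝ} {P : ProbabilityMeasure ℝ≥0}
    {Q : ℕ → ProbabilityMeasure ℝ≥0} (hQ : Tendsto Q atTop (𝓝 P))
    (hmem : ∀ n, Q n ∈ covertInputs ν) : P ∈ covertInputs ν := by
  change wardenDivergence P ≤ _
  rw [wardenDivergence_eq_lintegral]
  have hlim : ∀ y : ℝ, 0 ≤ y → Tendsto (fun n => ENNReal.ofReal
      (outPDF 1 (Q n) y * Real.log (outPDF 1 (Q n) y) + outPDF 1 (Q n) y * y + Real.exp (-y)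
        - outPDF 1 (Q n) y)) atTop (𝓝 (ENNReal.ofReal
      (outPDF 1 P y * Real.log (outPDF 1 P y) + outPDF 1 P y * y + Real.exp (-y)
        - outPDF 1 P y))) := by
    intro y hy
    have h1 := tendsto_outPDF (θ := 1) hQ hy
    refine (ENNReal.continuous_ofReal.tendsto _).comp ?_
    exact ((((Real.continuous_mul_log.tendsto _).comp h1).add (h1.mul_const y)).add_const _).sub h1
  calc _ = ∫⁻ y in Ici (0 : ℝ), liminf (fun n => ENNReal.ofReal
      (outPDF 1 (Q n) y * Real.log (outPDF 1 (Q n) y) + outPDF 1 (Q n) y * y + Real.exp (-y)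
        - outPDF 1 (Q n) y)) atTop :=
        setLIntegral_congr_fun measurableSet_Ici fun y hy => (hlim y hy).liminf_eq.symm
    _ ≤ liminf (fun n => ∫⁻ y in Ici (0 : ℝ), ENNReal.ofReal
      (outPDF 1 (Q n) y * Real.log (outPDF 1 (Q n) y) + outPDF 1 (Q n) y * y + Real.exp (-y)
        - outPDF 1 (Q n) y)) atTop := by
        refine lintegral_liminf_le fun n => ?_
        have hm : Measurable (outPDF 1 (Q n : Measure ℝ≥0)) := measurable_outPDF
        exact ((((hm.mul (Real.measurable_log.comp hm)).add (hm.mul measurable_id)).add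
          (by fun_prop)).sub hm).ennreal_ofReal
    _ = liminf (fun n => wardenDivergence (Q n)) atTop := by
        simp only [wardenDivergence_eq_lintegral]
    _ ≤ ENNReal.ofReal ν := by
        refine (liminf_le_liminf (Eventually.of_forall hmem)).trans ?_
        simp

theorem diracProba_zero_mem_covertInputs {ν : ℝ} (hν : 0 ≤ ν) :
    (diracProba 0 : ProbabilityMeasure ℝ≥0) ∈ covertInputs ν := by
  refine (mem_covertInputs_iff (P := diracProba 0) hν (finiteMean_dirac 0)).2 ?_
  exact cost_dirac_zero.trans_le hν

/-- Along a maximising subsequence the entropy converges, by the uniform mean bound. The mean of log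
s is only lower semicontinuous, but it enters the rate with a minus sign, which is the favourable
direction. -/
theorem exists_rate_max (θ : ℝ) {ν : ℝ} (hν : 0 ≤ ν) : ∃ P ∈ covertInputs ν,
    ∀ P' ∈ covertInputs ν, rate θ (P' : Measure ℝ≥0) ≤ rate θ (P : Measure ℝ≥0) := by
  set S : Set ℝ := (fun P : ProbabilityMeasure ℝ≥0 => rate θ (P : Measure ℝ≥0)) '' covertInputs ν
    with hS
  have hmean : ∀ P ∈ covertInputs ν, FiniteMean (P : Measure ℝ≥0) ∧
      ∫ x, (x : ℝ) ∂(P : Measure ℝ≥0) ≤ ν / (1 / 2) + 1 / 2 / (1 - 1 / 2) := fun P hP =>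
    mean_bound_of_mem_covertInputs hν one_half_pos one_half_lt_one hP
  have hne : S.Nonempty := ⟨_, _, diracProba_zero_mem_covertInputs hν, rfl⟩
  have hba : BddAbove S := by
    refine ⟨θ ^ 2 * (ν / (1 / 2) + 1 / 2 / (1 - 1 / 2)), ?_⟩
    rintro _ ⟨P, hP, rfl⟩
    exact (rate_le_mul_mean (hmean P hP).1).trans
      (mul_le_mul_of_nonneg_left (hmean P hP).2 (sq_nonneg θ))
  obtain ⟨u, -, hu, huS⟩ := exists_seq_tendsto_sSup hne hba
  choose Q hQ hQu using huS
  obtain ⟨P, -, k, hk, hP⟩ := (isCompact_closure_covertInputs hν).tendsto_subseq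
    fun n => subset_closure (hQ n)
  have hPmem : P ∈ covertInputs ν := mem_covertInputs_of_tendsto hP fun n => hQ (k n)
  refine ⟨P, hPmem, fun P' hP' => (le_csSup hba ⟨P', hP', rfl⟩).trans ?_⟩
  have hfm := (hmean P hPmem).1
  have h1 := tendsto_outEntropy (θ := θ) hP (fun n => (hmean _ (hQ (k n))).1)
    fun n => (hmean _ (hQ (k n))).2
  have h2 : Tendsto (fun n => rate θ (Q (k n) : Measure ℝ≥0)) atTop (𝓝 (sSup S)) := by
    refine (hu.comp hk.tendsto_atTop).congr fun n => ?_
    exact (hQu (k n)).symm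
  have h3 : Tendsto (fun n => ∫ x, Real.log (outScale θ x) ∂(Q (k n) : Measure ℝ≥0)) atTop
      (𝓝 (outEntropy θ (P : Measure ℝ≥0) - 1 - sSup S)) := by
    refine ((h1.sub_const 1).sub h2).congr fun n => ?_
    simp [rate]
  have hc : Continuous fun x => Real.log (outScale θ x) :=
    (continuous_outScale θ).log fun x => (outScale_pos θ x).ne'
  have hnn : ∀ x, 0 ≤ Real.log (outScale θ x) := fun x => Real.log_nonneg (one_le_outScale θ x)
  have h4 := lintegral_le_liminf_lintegral_of_forall_isOpen_measure_le_liminf_measure hc hnn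
    fun G hG => ProbabilityMeasure.le_liminf_measure_open_of_tendsto hP hG
  have h5 : ∀ R ∈ covertInputs ν, ∫⁻ x, ENNReal.ofReal (Real.log (outScale θ x))
      ∂(R : Measure ℝ≥0) = ENNReal.ofReal (∫ x, Real.log (outScale θ x) ∂(R : Measure ℝ≥0)) :=
    fun R hR => (ofReal_integral_eq_lintegral_ofReal
      (integrable_log_outScale (hmean R hR).1) (ae_of_all _ hnn)).symm
  rw [h5 P hPmem] at h4
  have h6 : Tendsto (fun n => ∫⁻ x, ENNReal.ofReal (Real.log (outScale θ x))
      ∂(Q (k n) : Measure ℝ≥0)) atTop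
      (𝓝 (ENNReal.ofReal (outEntropy θ (P : Measure ℝ≥0) - 1 - sSup S))) := by
    refine ((ENNReal.continuous_ofReal.tendsto _).comp h3).congr fun n => ?_
    exact (h5 _ (hQ (k n))).symm
  have h7 : 0 ≤ outEntropy θ (P : Measure ℝ≥0) - 1 - sSup S :=
    ge_of_tendsto' h3 fun n => integral_nonneg hnn
  have h8 : ∫ x, Real.log (outScale θ x) ∂(P : Measure ℝ≥0) ≤
      outEntropy θ (P : Measure ℝ≥0) - 1 - sSup S := by
    rw [← ENNReal.ofReal_le_ofReal_iff h7]
    refine h4.trans (le_of_eq ?_)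
    exact h6.liminf_eq
  rw [rate]
  linarith

end Existence

/-! ### Uniqueness of Laplace transforms at integer points -/

/-- The positive and negative parts of g are densities of finite measures with the same moments of
exp(-z), so these measures coincide. -/
theorem ae_eq_zero_of_integral_exp_eq_zero {g : ℝ → ℝ} (hg : IntegrableOn g (Ici 0))
    (h : ∀ n : ℕ, ∫ z in Ici (0 : ℝ), Real.exp (-(n * z)) * g z = 0) :
    g =ᵐ[volume.restrict (Ici (0 : ℝ))] 0 := by
  set m : Measure ℝ := volume.restrict (Ici (0 : ℝ)) with hm
  -- Extends exp(-z) from the half-line to a bounded, continuous, strictly decreasing function on ℝ,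
  -- equal to 2 - exp z for z < 0.
  let φ : ℝ → ℝ := fun z => Real.exp (-max z 0) + 1 - Real.exp (min z 0)
  have hφc : Continuous φ := by fun_prop
  have hφe : ∀ z, 0 ≤ z → φ z = Real.exp (-z) := by
    intro z hz; simp [φ, max_eq_left hz, min_eq_right hz]
  have hφ : StrictAnti φ := by
    intro z w hzw
    have h1 : max z 0 ≤ max w 0 := max_le_max_right 0 hzw.le
    have h2 : min z 0 ≤ min w 0 := min_le_min_right 0 hzw.le
    have h3 : Real.exp (-max w 0) ≤ Real.exp (-max z 0) := Real.exp_le_exp.2 (by linarith)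
    have h4 : Real.exp (min z 0) ≤ Real.exp (min w 0) := Real.exp_le_exp.2 h2
    rcases lt_or_ge z 0 with hz | hz
    · have : min z 0 < min w 0 := by
        rw [min_eq_left hz.le]; exact lt_min hzw hz
      have := Real.exp_lt_exp.2 this
      simp only [φ]; linarith
    · have : max z 0 < max w 0 := by
        rw [max_eq_left hz, max_eq_left (hz.trans hzw.le)]; exact hzw
      have : Real.exp (-max w 0) < Real.exp (-max z 0) := Real.exp_lt_exp.2 (by linarith)
      simp only [φ]; linarith
  have hφb : ∀ z, ‖φ z‖ ≤ 2 := by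
    intro z
    have h1 : Real.exp (-max z 0) ≤ 1 := by
      rw [Real.exp_le_one_iff]; linarith [le_max_right z 0]
    have h2 : Real.exp (min z 0) ≤ 1 := by
      rw [Real.exp_le_one_iff]; exact min_le_right z 0
    have h3 := Real.exp_pos (-max z 0)
    have h4 := Real.exp_pos (min z 0)
    rw [Real.norm_eq_abs, abs_le]
    simp only [φ]
    constructor <;> linarith
  have hgm : AEMeasurable g m := hg.aestronglyMeasurable.aemeasurable
  have hgm' : AEMeasurable (fun z => -g z) m := hgm.neg
  have hfin1 : IsFiniteMeasure (m.withDensity fun z => ENNReal.ofReal (g z)) :=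
    isFiniteMeasure_withDensity_ofReal hg.hasFiniteIntegral
  have hfin2 : IsFiniteMeasure (m.withDensity fun z => ENNReal.ofReal (-g z)) :=
    isFiniteMeasure_withDensity_ofReal hg.neg.hasFiniteIntegral
  have heq : m.withDensity (fun z => ENNReal.ofReal (g z)) =
      m.withDensity fun z => ENNReal.ofReal (-g z) := by
    refine measure_ext_of_integral_pow hφc hφ.injective hφb fun n => ?_
    rw [integral_withDensity_eq_integral_toReal_smul₀ hgm.ennreal_ofReal
        (ae_of_all _ fun _ => by simp),
      integral_withDensity_eq_integral_toReal_smul₀ hgm'.ennreal_ofReal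
        (ae_of_all _ fun _ => by simp)]
    have hpow : ∀ G : ℝ → ℝ, Integrable G m → Integrable (fun z => G z * φ z ^ n) m := by
      intro G hG
      refine hG.mul_bdd (c := 2 ^ n) (hφc.pow n).aestronglyMeasurable (ae_of_all _ fun z => ?_)
      rw [norm_pow]
      exact pow_le_pow_left₀ (norm_nonneg _) (hφb z) n
    have i1 := hpow (fun z => max (g z) 0) hg.pos_part
    have i2 := hpow (fun z => max (-g z) 0) hg.neg_part
    simp only [ENNReal.toReal_ofReal', smul_eq_mul]
    rw [← sub_eq_zero]
    refine (integral_sub i1 i2).symm.trans ?_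
    refine Eq.trans ?_ (h n)
    refine setIntegral_congr_fun measurableSet_Ici fun z hz => ?_
    simp only [hφe z hz, ← Real.exp_nat_mul, ← sub_mul, max_zero_sub_eq_self]
    rw [mul_comm]
    congr 2
    ring
  rw [withDensity_eq_iff_of_sigmaFinite hgm.ennreal_ofReal hgm'.ennreal_ofReal] at heq
  filter_upwards [heq] with z hz
  change g z = 0
  rcases le_total (g z) 0 with h0 | h0
  · rw [ENNReal.ofReal_of_nonpos h0] at hz
    have := ENNReal.ofReal_eq_zero.1 hz.symm
    exact le_antisymm h0 (by linarith)
  · rw [ENNReal.ofReal_of_nonpos (p := -g z) (by linarith)] at hz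
    exact le_antisymm (ENNReal.ofReal_eq_zero.1 hz) h0

/-! ### The Borel transform of a power series -/

section Borel

variable {b : ℕ → ℝ} {K R : ℝ}

/-- The exponential generating function of a sequence. -/
noncomputable def borel (b : ℕ → ℝ) (z : ℂ) : ℂ := ∑' n, (b n : ℂ) / n.factorial * z ^ n

theorem norm_borel_term_le (hb : ∀ n, |b n| ≤ K / R ^ n) {ρ : ℝ} {z : ℂ}
    (hz : ‖z‖ ≤ ρ) (n : ℕ) :
    ‖(b n : ℂ) / n.factorial * z ^ n‖ ≤ K * ((ρ / R) ^ n / n.factorial) := by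
  have hK : 0 ≤ K / R ^ n := (abs_nonneg _).trans (hb n)
  rw [norm_mul, norm_div, norm_pow, Complex.norm_real, Complex.norm_natCast, Real.norm_eq_abs]
  calc |b n| / n.factorial * ‖z‖ ^ n ≤ K / R ^ n / n.factorial * ρ ^ n := by
        gcongr; exact hb n
    _ = _ := by rw [div_pow]; ring

theorem differentiable_borel (hb : ∀ n, |b n| ≤ K / R ^ n) :
    Differentiable ℂ (borel b) := by
  intro z
  have h := Complex.differentiableOn_tsum_of_summable_norm (U := Metric.ball (0 : ℂ) (‖z‖ + 1))
    (F := fun n z => (b n : ℂ) / n.factorial * z ^ n)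
    ((Real.summable_pow_div_factorial ((‖z‖ + 1) / R)).mul_left K) (fun n => by fun_prop)
    Metric.isOpen_ball
    fun n w hw => norm_borel_term_le hb (by simpa using (mem_ball_zero_iff.1 hw).le) n
  exact h.differentiableAt (Metric.isOpen_ball.mem_nhds (by simp))

theorem norm_borel_le (hb : ∀ n, |b n| ≤ K / R ^ n) (z : ℂ) :
    ‖borel b z‖ ≤ K * Real.exp (‖z‖ / R) := by
  have h1 : HasSum (fun n : ℕ => K * ((‖z‖ / R) ^ n / n.factorial)) (K * Real.exp (‖z‖ / R)) := by
    rw [Real.exp_eq_exp_ℝ]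
    exact (NormedSpace.expSeries_div_hasSum_exp (‖z‖ / R)).mul_left K
  exact tsum_of_norm_bounded h1 (norm_borel_term_le hb le_rfl)

theorem borel_ofReal_re (x : ℝ) : (borel b x).re = ∑' n, b n / n.factorial * x ^ n := by
  rw [borel]
  have : (∑' n, (b n : ℂ) / n.factorial * (x : ℂ) ^ n) =
      ((∑' n, b n / n.factorial * x ^ n : ℝ) : ℂ) := by
    rw [Complex.ofReal_tsum]
    push_cast
    rfl
  rw [this, Complex.ofReal_re]

theorem borel_ofReal_im (x : ℝ) : (borel b x).im = 0 := by
  rw [borel]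
  have : (∑' n, (b n : ℂ) / n.factorial * (x : ℂ) ^ n) =
      ((∑' n, b n / n.factorial * x ^ n : ℝ) : ℂ) := by
    rw [Complex.ofReal_tsum]
    push_cast
    rfl
  rw [this, Complex.ofReal_im]

/-- Termwise integration: the kernel sends y^n / n! to t^n, and t < R gives absolute summability. -/
theorem hasSum_integral_borel (hR : 0 < R) (hb : ∀ n, |b n| ≤ K / R ^ n) {t : ℝ} (ht : 0 < t)
    (htR : t < R) :
    HasSum (fun n => b n * t ^ n)
      (∫ y in Ici (0 : ℝ), 1 / t * Real.exp (-(y / t)) * (borel b y).re) := by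
  have hint : ∀ n : ℕ, IntegrableOn
      (fun y : ℝ => b n / n.factorial * (1 / t * Real.exp (-(y / t)) * y ^ n)) (Ici 0) :=
    fun n => (integrableOn_exp_mul_pow ht n).const_mul _
  have hnorm : ∀ n : ℕ, ∫ y in Ici (0 : ℝ),
      ‖b n / n.factorial * (1 / t * Real.exp (-(y / t)) * y ^ n)‖ = |b n| * t ^ n := by
    intro n
    calc _ = ∫ y in Ici (0 : ℝ), |b n| / n.factorial * (1 / t * Real.exp (-(y / t)) * y ^ n) := by
          refine setIntegral_congr_fun measurableSet_Ici fun y hy => ?_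
          have hy0 : 0 ≤ y := hy
          rw [norm_mul, norm_div, Real.norm_eq_abs, Real.norm_natCast,
            Real.norm_of_nonneg (by positivity)]
      _ = |b n| * t ^ n := by
          rw [integral_const_mul, integral_exp_mul_pow ht]
          field_simp
  have hsum : Summable fun n : ℕ => |b n| * t ^ n := by
    refine Summable.of_nonneg_of_le (fun n => by positivity) (fun n => ?_)
      ((summable_geometric_of_lt_one (div_pos ht hR).le ((div_lt_one hR).2 htR)).mul_left K)
    calc |b n| * t ^ n ≤ K / R ^ n * t ^ n := by gcongr; exact hb n
      _ = K * (t / R) ^ n := by rw [div_pow]; ring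
  have h := hasSum_integral_of_summable_integral_norm hint (by simpa only [hnorm] using hsum)
  have e1 : (fun n => b n * t ^ n) = fun n : ℕ => ∫ y in Ici (0 : ℝ),
      b n / n.factorial * (1 / t * Real.exp (-(y / t)) * y ^ n) := by
    funext n
    rw [integral_const_mul, integral_exp_mul_pow ht]
    field_simp
  have e2 : ∫ y in Ici (0 : ℝ), 1 / t * Real.exp (-(y / t)) * (borel b y).re =
      ∫ y in Ici (0 : ℝ), ∑' n : ℕ, b n / n.factorial * (1 / t * Real.exp (-(y / t)) * y ^ n) := by
    refine integral_congr_ae (ae_of_all _ fun y => ?_)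
    simp only [borel_ofReal_re]
    rw [← tsum_mul_left]
    refine tsum_congr fun n => ?_
    ring
  rw [e1, e2]
  exact h

/-- A function on the half-line whose Laplace transform `t ↦ ∫ t⁻¹ exp (-y/t) f y` is a convergent
power series near `0` is the Borel transform of that series. -/
theorem eq_borel_of_hasSum_laplace (hR : 0 < R) (hb : ∀ n, |b n| ≤ K / R ^ n) {f : ℝ → ℝ} {c : ℝ}
    (hfm : Measurable f) (hfc : ContinuousOn f (Ici 0)) (hfb : ∀ y, 0 ≤ y → |f y| ≤ c + 1 * y)
    (hsum : ∀ t, 0 < t → t < R →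
      HasSum (fun n => b n * t ^ n) (∫ y in Ici (0 : ℝ), 1 / t * Real.exp (-(y / t)) * f y))
    {z : ℝ} (hz : 0 ≤ z) : f z = (borel b z).re := by
  have hEc : Continuous fun y : ℝ => (borel b y).re :=
    Complex.continuous_re.comp
      ((differentiable_borel hb).continuous.comp Complex.continuous_ofReal)
  have hfi : ∀ t, 0 < t → IntegrableOn (fun y => 1 / t * Real.exp (-(y / t)) * f y) (Ici 0) := by
    intro t ht
    refine (((integrableOn_exp_mul_pow ht 0).const_mul c).add (integrableOn_exp_mul_pow ht 1)).mono'
      (by fun_prop) ?_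
    filter_upwards [ae_restrict_mem measurableSet_Ici] with y hy
    have h1 := hfb y hy
    have h2 : 0 ≤ 1 / t * Real.exp (-(y / t)) := by positivity
    rw [norm_mul, Real.norm_of_nonneg h2, Real.norm_eq_abs]
    simp only [Pi.add_apply, pow_zero, pow_one, mul_one]
    nlinarith [mul_le_mul_of_nonneg_left h1 h2]
  have hEi : ∀ t, 0 < t → t < R →
      IntegrableOn (fun y : ℝ => 1 / t * Real.exp (-(y / t)) * (borel b y).re) (Ici 0) := by
    intro t ht htR
    have hd : 0 < 1 / t - 1 / R := sub_pos.2 (one_div_lt_one_div_of_lt ht htR)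
    have h0 := (integrableOn_exp_mul_pow (inv_pos.2 hd) 0).const_mul (1 / t * K / (1 / t - 1 / R))
    refine h0.mono' (by fun_prop) ?_
    filter_upwards [ae_restrict_mem measurableSet_Ici] with y hy
    have hy0 : 0 ≤ y := hy
    have h2 : 0 ≤ 1 / t * Real.exp (-(y / t)) := by positivity
    rw [norm_mul, Real.norm_of_nonneg h2]
    have h3 : ‖(borel b y).re‖ ≤ K * Real.exp (y / R) := by
      have := (Complex.abs_re_le_norm (borel b y)).trans (norm_borel_le hb (y : ℂ))
      rwa [Complex.norm_real, Real.norm_of_nonneg hy0] at this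
    refine (mul_le_mul_of_nonneg_left h3 h2).trans (le_of_eq ?_)
    have h4 : Real.exp (-(y / (1 / t - 1 / R)⁻¹)) = Real.exp (-(y / t)) * Real.exp (y / R) := by
      rw [← Real.exp_add, div_inv_eq_mul]; congr 1; ring
    have hRt : R - t ≠ 0 := (sub_pos.2 htR).ne'
    rw [h4, one_div (1 / t - 1 / R)⁻¹, inv_inv, pow_zero]
    field_simp
  -- For s ≥ p the point t = 1/s lies below R, so both Laplace transforms exist and agree there.
  obtain ⟨p, hp⟩ := exists_nat_gt (1 / R)
  have hp0 : (0 : ℝ) < p := (by positivity : 0 < 1 / R).trans hp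
  have hzero : ∀ s : ℝ, (p : ℝ) ≤ s →
      IntegrableOn (fun y : ℝ => Real.exp (-(s * y)) * (f y - (borel b y).re)) (Ici 0) ∧
      ∫ y in Ici (0 : ℝ), Real.exp (-(s * y)) * (f y - (borel b y).re) = 0 := by
    intro s hs
    have hs0 : 0 < s := hp0.trans_le hs
    have ht : 0 < 1 / s := by positivity
    have htR : 1 / s < R := by
      rw [div_lt_iff₀ hs0]
      rw [div_lt_iff₀ hR] at hp
      nlinarith
    have hc1 : (fun y : ℝ => Real.exp (-(s * y)) * (f y - (borel b y).re)) = fun y =>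
        1 / s * (1 / (1 / s) * Real.exp (-(y / (1 / s))) * f y
          - 1 / (1 / s) * Real.exp (-(y / (1 / s))) * (borel b y).re) := by
      funext y
      have : y / (1 / s) = s * y := by rw [div_div_eq_mul_div, div_one]; ring
      rw [this, one_div_one_div]
      field_simp
    rw [hc1]
    refine ⟨((hfi _ ht).sub (hEi _ ht htR)).const_mul _, ?_⟩
    rw [integral_const_mul, integral_sub (hfi _ ht) (hEi _ ht htR),
      (hsum _ ht htR).unique (hasSum_integral_borel hR hb ht htR), sub_self, mul_zero]
  -- The factor exp(-py) is absorbed into the function, so the known points p + n become the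
  -- required points n.
  have hae := ae_eq_zero_of_integral_exp_eq_zero (hzero p le_rfl).1 fun n => by
    refine Eq.trans ?_ (hzero (p + n) (by simp)).2
    refine integral_congr_ae (ae_of_all _ fun y => ?_)
    simp only
    rw [← mul_assoc, ← Real.exp_add]
    congr 2
    ring
  have hae' : f =ᵐ[volume.restrict (Ici (0 : ℝ))] fun y => (borel b y).re := by
    filter_upwards [hae] with y hy
    rcases mul_eq_zero.1 hy with h | h
    · exact absurd h (Real.exp_pos _).ne'
    · linarith
  exact Measure.eqOn_of_ae_eq hae' hfc hEc.continuousOn (by simp) hz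

end Borel

/-! ### Entire functions with linearly bounded real part -/

/-- Borel–Carathéodory on a disc of radius 2(‖z‖ + 1) upgrades the bound on the real part to linear
growth of the modulus; Cauchy estimates on growing circles then kill the second derivative. -/
theorem affine_of_re_le {g : ℂ → ℂ} (hg : Differentiable ℂ g) (hre : ∀ z, (g z).re ≤ ‖z‖) :
    ∃ a k : ℂ, ∀ z, g z = a + k * z := by
  have hbound : ∀ z : ℂ, ‖g z‖ ≤ 4 * (‖z‖ + 1) + 3 * ‖g 0‖ := by
    intro z
    set r := ‖z‖ + 1 with hr
    have hr0 : 0 < r := by positivity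
    have hzr : ‖z‖ < r := by linarith
    have h := Complex.borelCaratheodory (f := g) (M := 2 * r) (R := 2 * r) (z := z)
      (by positivity) hg.differentiableOn
      (fun w hw => (hre w).trans (mem_ball_zero_iff.1 hw).le) (by positivity)
      (mem_ball_zero_iff.2 (by linarith))
    have hd : r ≤ 2 * r - ‖z‖ := by linarith
    refine h.trans (add_le_add ?_ ?_)
    · rw [div_le_iff₀ (by linarith)]
      nlinarith [norm_nonneg z]
    · rw [div_le_iff₀ (by linarith)]
      nlinarith [norm_nonneg (g 0), mul_nonneg (norm_nonneg (g 0)) (norm_nonneg z),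
        mul_nonneg (norm_nonneg (g 0)) (sub_nonneg.2 hzr.le)]
  have h2 : ∀ c, iteratedDeriv 2 g c = 0 := by
    intro c
    have hle : ∀ ρ : ℝ, 1 ≤ ρ → ‖iteratedDeriv 2 g c‖ ≤
        2 * (4 * (‖c‖ + 2) + 3 * ‖g 0‖) / ρ := by
      intro ρ hρ
      have hρ0 : 0 < ρ := by linarith
      have h := Complex.norm_iteratedDeriv_le_of_forall_mem_sphere_norm_le (c := c) (R := ρ)
        (C := (4 * (‖c‖ + 2) + 3 * ‖g 0‖) * ρ) (f := g) 2 hρ0 hg.diffContOnCl fun z hz => by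
          refine (hbound z).trans ?_
          have h1 : ‖z‖ ≤ ‖c‖ + ρ := by
            have := norm_add_le c (z - c)
            rw [add_sub_cancel, mem_sphere_iff_norm.1 hz] at this
            exact this
          nlinarith [norm_nonneg c, norm_nonneg (g 0), mul_nonneg (norm_nonneg c) (sub_nonneg.2 hρ),
            mul_nonneg (norm_nonneg (g 0)) (sub_nonneg.2 hρ)]
      refine h.trans (le_of_eq ?_)
      simp only [Nat.factorial_two, Nat.cast_ofNat]
      field_simp
    have ht : Tendsto (fun ρ : ℝ => 2 * (4 * (‖c‖ + 2) + 3 * ‖g 0‖) / ρ) atTop (𝓝 0) :=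
      tendsto_const_nhds.div_atTop tendsto_id
    have := ge_of_tendsto ht (eventually_atTop.2 ⟨1, fun ρ hρ => hle ρ hρ⟩)
    exact norm_le_zero_iff.1 this
  have hd : Differentiable ℂ (deriv g) := fun z =>
    (hg.analyticAt z).deriv.differentiableAt
  have h3 : ∀ z, deriv (deriv g) z = 0 := by
    intro z
    have := h2 z
    rwa [iteratedDeriv_succ, iteratedDeriv_one] at this
  have h4 : ∀ z, deriv g z = deriv g 0 := fun z => is_const_of_deriv_eq_zero hd h3 z 0
  have h5 : Differentiable ℂ fun z => g z - deriv g 0 * z := by fun_prop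
  have h6 : ∀ z, deriv (fun z => g z - deriv g 0 * z) z = 0 := by
    intro z
    rw [deriv_fun_sub (hg z) (by fun_prop), deriv_const_mul _ differentiableAt_id, h4 z]
    simp
  refine ⟨g 0, deriv g 0, fun z => ?_⟩
  have := is_const_of_deriv_eq_zero h5 h6 z 0
  simp only [mul_zero, sub_zero] at this
  rw [← this]
  ring

/-! ### Holomorphic extension of the cross entropy -/

section Extension

variable {θ l : ℝ} {μ : Measure ℝ≥0}

/-- The cross entropy of an exponential law of mean `s` relative to the output law of `μ`. -/
noncomputable def crossEntR (θ : ℝ) (μ : Measure ℝ≥0) (s : ℝ) : ℝ :=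
  ∫ y in Ici (0 : ℝ), 1 / s * Real.exp (-(y / s)) * -Real.log (outPDF θ μ y)

theorem crossEnt_eq_crossEntR (x : ℝ≥0) : crossEnt θ μ x = crossEntR θ μ (outScale θ x) := rfl

theorem crossEntR_nonneg [IsProbabilityMeasure μ] {s : ℝ} (hs : 0 < s) : 0 ≤ crossEntR θ μ s :=
  setIntegral_nonneg measurableSet_Ici fun _ hy =>
    mul_nonneg (by positivity) (neg_log_outPDF_nonneg hy)

theorem measurable_neg_log_outPDF [SFinite μ] :
    Measurable fun y => -Real.log (outPDF θ μ y) := measurable_log_outPDF.neg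

/-- The measure on the half-line with density `-log` of the output density. -/
noncomputable def surprisal (θ : ℝ) (μ : Measure ℝ≥0) : Measure ℝ :=
  (volume.restrict (Ici (0 : ℝ))).withDensity fun y => ENNReal.ofReal (-Real.log (outPDF θ μ y))

/-- The holomorphic extension of `crossEntR` to the right half-plane. -/
noncomputable def crossEntC (θ : ℝ) (μ : Measure ℝ≥0) (s : ℂ) : ℂ :=
  1 / s * complexMGF id (surprisal θ μ) (-(1 / s))

theorem crossEntC_ofReal [IsProbabilityMeasure μ] (s : ℝ) :
    crossEntC θ μ s = crossEntR θ μ s := by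
  have h1 : mgf id (surprisal θ μ) (-(1 / s)) =
      ∫ y in Ici (0 : ℝ), -Real.log (outPDF θ μ y) * Real.exp (-(y / s)) := by
    rw [mgf, surprisal, integral_withDensity_eq_integral_toReal_smul
      measurable_neg_log_outPDF.ennreal_ofReal (ae_of_all _ fun _ => by simp)]
    refine setIntegral_congr_fun measurableSet_Ici fun y hy => ?_
    simp only [smul_eq_mul, id_eq]
    rw [ENNReal.toReal_ofReal (neg_log_outPDF_nonneg hy)]
    congr 2
    ring
  have h2 : (-(1 / (s : ℂ))) = ((-(1 / s) : ℝ) : ℂ) := by push_cast; rfl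
  rw [crossEntC, h2, complexMGF_ofReal, h1, crossEntR]
  rw [← Complex.ofReal_one, ← Complex.ofReal_div, ← Complex.ofReal_mul, ← integral_const_mul]
  congr 1
  refine integral_congr_ae (ae_of_all _ fun y => ?_)
  simp only
  ring

theorem Iio_subset_integrableExpSet_surprisal [IsProbabilityMeasure μ] :
    Iio 0 ⊆ integrableExpSet id (surprisal θ μ) := by
  intro τ hτ
  have hτ0 : 0 < -τ := neg_pos.2 hτ
  obtain ⟨c, -, hc⟩ := abs_neg_log_outPDF_le (θ := θ) (μ := μ)
  change Integrable (fun y => Real.exp (τ * id y)) (surprisal θ μ)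
  rw [surprisal, integrable_withDensity_iff_integrable_smul'
    measurable_neg_log_outPDF.ennreal_ofReal (ae_of_all _ fun _ => by simp)]
  have hs : 0 < (-τ)⁻¹ := inv_pos.2 hτ0
  refine ((((integrableOn_exp_mul_pow hs 0).const_mul c).add
    (integrableOn_exp_mul_pow hs 1)).const_mul (-τ)⁻¹).mono' ?_ ?_
  · exact (measurable_neg_log_outPDF.ennreal_ofReal.ennreal_toReal.smul
      (by fun_prop)).aestronglyMeasurable
  · filter_upwards [ae_restrict_mem measurableSet_Ici] with y hy
    have h1 := hc y hy
    rw [abs_of_nonneg (neg_log_outPDF_nonneg hy)] at h1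
    rw [ENNReal.toReal_ofReal (neg_log_outPDF_nonneg hy), smul_eq_mul,
      Real.norm_of_nonneg (mul_nonneg (neg_log_outPDF_nonneg hy) (Real.exp_pos _).le)]
    have h2 : Real.exp (-(y / (-τ)⁻¹)) = Real.exp (τ * id y) := by
      congr 1; rw [div_inv_eq_mul, id]; ring
    have h3 : (-τ)⁻¹ * (1 / (-τ)⁻¹) = 1 := mul_one_div_cancel hs.ne'
    simp only [Pi.add_apply, pow_zero, pow_one, mul_one, h2]
    calc _ ≤ (c + 1 * y) * Real.exp (τ * id y) :=
          mul_le_mul_of_nonneg_right h1 (Real.exp_pos _).le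
      _ = (-τ)⁻¹ * (1 / (-τ)⁻¹) * ((c + 1 * y) * Real.exp (τ * id y)) := by rw [h3]; ring
      _ = _ := by ring

/-- The surprisal grows at most linearly, so exp(τy) is integrable against it for every τ < 0, and
Re s > 0 puts -1/s in that half-plane. -/
theorem analyticAt_crossEntC [IsProbabilityMeasure μ] {s : ℂ} (hs : 0 < s.re) :
    AnalyticAt ℂ (crossEntC θ μ) s := by
  have hs0 : s ≠ 0 := fun h => by simp [h] at hs
  have h1 : AnalyticAt ℂ (fun s : ℂ => 1 / s) s := analyticAt_const.div analyticAt_id hs0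
  refine h1.mul ?_
  refine AnalyticAt.fun_comp (f := fun s : ℂ => -(1 / s)) (g := complexMGF id (surprisal θ μ)) ?_ h1.neg
  refine analyticAt_complexMGF (interior_maximal Iio_subset_integrableExpSet_surprisal isOpen_Iio ?_)
  rw [mem_Iio, Complex.neg_re, one_div, Complex.inv_re, neg_lt_zero]
  exact div_pos hs (Complex.normSq_pos.2 hs0)

/-- The holomorphic extension of the Lagrangian density. -/
noncomputable def lagrangianC (θ l : ℝ) (μ : Measure ℝ≥0) (z : ℂ) : ℂ :=
  crossEntC θ μ (θ ^ 2 * z + 1) - 1 - Complex.log (θ ^ 2 * z + 1)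
    - l * (z + 1 - crossEntC 1 μ (z + 1))

theorem analyticAt_lagrangianC [IsProbabilityMeasure μ] {z : ℂ}
    (h1 : 0 < ((θ : ℂ) ^ 2 * z + 1).re) (h2 : 0 < (z + 1).re) :
    AnalyticAt ℂ (lagrangianC θ l μ) z := by
  have a1 : AnalyticAt ℂ (fun z : ℂ => (θ : ℂ) ^ 2 * z + 1) z := by fun_prop
  have a2 : AnalyticAt ℂ (fun z : ℂ => z + 1) z := by fun_prop
  have b1 : AnalyticAt ℂ (fun z : ℂ => crossEntC θ μ ((θ : ℂ) ^ 2 * z + 1)) z :=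
    AnalyticAt.fun_comp (analyticAt_crossEntC h1) a1
  have b2 : AnalyticAt ℂ (fun z : ℂ => crossEntC 1 μ (z + 1)) z :=
    AnalyticAt.fun_comp (analyticAt_crossEntC h2) a2
  have b3 : AnalyticAt ℂ (fun z : ℂ => Complex.log ((θ : ℂ) ^ 2 * z + 1)) z :=
    a1.clog (Or.inl h1)
  exact ((b1.sub analyticAt_const).sub b3).sub (analyticAt_const.mul (a2.sub b2))

theorem lagrangianC_ofReal [IsProbabilityMeasure μ] {x : ℝ} (hx : 0 ≤ θ ^ 2 * x + 1) :
    lagrangianC θ l μ x = ((crossEntR θ μ (θ ^ 2 * x + 1) - 1 - Real.log (θ ^ 2 * x + 1)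
      - l * (x + 1 - crossEntR 1 μ (x + 1)) : ℝ) : ℂ) := by
  have h1 : (θ : ℂ) ^ 2 * x + 1 = ((θ ^ 2 * x + 1 : ℝ) : ℂ) := by push_cast; rfl
  have h2 : (x : ℂ) + 1 = ((x + 1 : ℝ) : ℂ) := by push_cast; rfl
  rw [lagrangianC, h1, h2, crossEntC_ofReal, crossEntC_ofReal, ← Complex.ofReal_log hx]
  push_cast
  rfl

theorem lagrangianC_coe [IsProbabilityMeasure μ] (x : ℝ≥0) :
    lagrangianC θ l μ (x : ℝ) = lagrangian θ l μ x := by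
  rw [lagrangianC_ofReal (outScale_pos θ x).le]
  have : outScale 1 x = x + 1 := by simp [outScale]
  rw [lagrangian, crossEnt_eq_crossEntR, crossEnt_eq_crossEntR, this]
  rfl

theorem extension_domain (x : ℝ≥0) :
    0 < ((θ : ℂ) ^ 2 * (x : ℝ) + 1).re ∧ 0 < (((x : ℝ) : ℂ) + 1).re := by
  have h1 : (θ : ℂ) ^ 2 * (x : ℝ) + 1 = ((θ ^ 2 * x + 1 : ℝ) : ℂ) := by push_cast; rfl
  have h2 : ((x : ℝ) : ℂ) + 1 = ((x + 1 : ℝ) : ℂ) := by push_cast; rfl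
  rw [h1, h2, Complex.ofReal_re, Complex.ofReal_re]
  have := x.2
  exact ⟨outScale_pos θ x, by positivity⟩

theorem continuous_lagrangian [IsProbabilityMeasure μ] : Continuous (lagrangian θ l μ) := by
  have h : lagrangian θ l μ = fun x : ℝ≥0 => (lagrangianC θ l μ (x : ℝ)).re := by
    funext x; rw [lagrangianC_coe, Complex.ofReal_re]
  rw [h]
  refine Complex.continuous_re.comp (continuous_iff_continuousAt.2 fun x => ?_)
  obtain ⟨h1, h2⟩ := extension_domain (θ := θ) x
  exact ContinuousAt.comp (f := fun x : ℝ≥0 => ((x : ℝ) : ℂ)) (g := lagrangianC θ l μ)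
    (analyticAt_lagrangianC h1 h2).continuousAt (by fun_prop)

/-- Continuity makes the equality set closed, so a set of full measure can be replaced by the
support. -/
theorem lagrangian_eq_of_mem_support [IsProbabilityMeasure μ] {C : ℝ}
    (h : ∀ᵐ x ∂μ, lagrangian θ l μ x = C) {x : ℝ≥0} (hx : x ∈ μ.support) :
    lagrangian θ l μ x = C :=
  Measure.support_subset_of_isClosed (t := {x | lagrangian θ l μ x = C})
    (isClosed_eq continuous_lagrangian continuous_const) h hx

/-- If the support is bounded and infinite, the optimality condition holds as an identity on the
whole domain of holomorphy. -/
theorem lagrangian_identity [IsProbabilityMeasure μ] {C : ℝ}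
    (h : ∀ x ∈ μ.support, lagrangian θ l μ x = C) (hinf : μ.support.Infinite) {B : ℝ≥0}
    (hB : μ.support ⊆ Icc 0 B) {t : ℝ} (ht : 0 < t) (hs : 0 < θ ^ 2 * (t - 1) + 1) :
    crossEntR θ μ (θ ^ 2 * (t - 1) + 1) - 1 - Real.log (θ ^ 2 * (t - 1) + 1)
      - l * (t - crossEntR 1 μ t) = C := by
  obtain ⟨x₀, -, hx₀⟩ := hinf.exists_accPt_of_subset_isCompact isCompact_Icc hB
  -- An intersection of two half-planes, convex and hence connected. It contains negative reals, so
  -- the identity will reach t < 1 in the variable t = 1 + x.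
  set U : Set ℂ := {z | 0 < ((θ : ℂ) ^ 2 * z + 1).re} ∩ {z | 0 < (z + 1).re} with hU
  have hre : ∀ z : ℂ, ((θ : ℂ) ^ 2 * z + 1).re = θ ^ 2 * z.re + 1 := by
    intro z
    have : ((θ : ℂ) ^ 2 * z + 1) = ((θ ^ 2 : ℝ) : ℂ) * z + 1 := by push_cast; rfl
    rw [this, Complex.add_re, Complex.re_ofReal_mul, Complex.one_re]
  have hconv : Convex ℝ U := by
    intro z hz w hw a b ha hb hab
    simp only [hU, mem_inter_iff, mem_ofPred_eq, hre, Complex.add_re, Complex.one_re,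
      Complex.smul_re, smul_eq_mul] at hz hw ⊢
    rcases ha.eq_or_lt with rfl | ha'
    · have : b = 1 := by linarith
      subst this
      simpa using hw
    · constructor
      · nlinarith [mul_pos ha' hz.1, mul_nonneg hb hw.1.le]
      · nlinarith [mul_pos ha' hz.2, mul_nonneg hb hw.2.le]
  have hfreq : ∃ᶠ z in 𝓝[≠] ((x₀ : ℝ) : ℂ), lagrangianC θ l μ z = (fun _ => (C : ℂ)) z := by
    have htend : Tendsto (fun x : ℝ≥0 => ((x : ℝ) : ℂ)) (𝓝[≠] x₀) (𝓝[≠] ((x₀ : ℝ) : ℂ)) := by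
      refine tendsto_nhdsWithin_of_tendsto_nhds_of_eventually_within _ ?_ ?_
      · exact (Continuous.tendsto (by fun_prop) x₀).mono_left nhdsWithin_le_nhds
      · filter_upwards [self_mem_nhdsWithin] with x hx
        intro e
        exact hx (NNReal.coe_injective (Complex.ofReal_injective e))
    refine htend.frequently ((accPt_iff_frequently_nhdsNE.1 hx₀).mono fun x hx => ?_)
    rw [lagrangianC_coe, h x hx]
  have hid := AnalyticOnNhd.eqOn_of_preconnected_of_frequently_eq
    (fun z hz => analyticAt_lagrangianC (l := l) (μ := μ) hz.1 hz.2)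
    (fun z _ => analyticAt_const) hconv.isPreconnected (extension_domain (θ := θ) x₀) hfreq
  have hmem : ((t - 1 : ℝ) : ℂ) ∈ U := by
    simp only [hU, mem_inter_iff, mem_ofPred_eq, hre, Complex.add_re, Complex.one_re,
      Complex.ofReal_re]
    exact ⟨hs, by linarith⟩
  have := hid hmem
  rw [lagrangianC_ofReal hs.le, sub_add_cancel] at this
  exact Complex.ofReal_injective this

end Extension

/-! ### Boundedness of the support -/

theorem crossEnt_le {θ : ℝ} {μ : Measure ℝ≥0} [IsProbabilityMeasure μ] {a b : ℝ≥0}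
    (hab : 0 < μ.real (Icc a b)) (x : ℝ≥0) :
    crossEnt θ μ x ≤ -Real.log (μ.real (Icc a b) / outScale θ b)
      + outScale θ x / outScale θ a := by
  set c := -Real.log (μ.real (Icc a b) / outScale θ b)
  have i1 := (integrableOn_rayleighPDF θ x).mul_const c
  have i2 := (integrableOn_rayleighPDF_mul_self θ x).mul_const (1 / outScale θ a)
  have e : ∫ y in Ici (0 : ℝ), (rayleighPDF θ x y * c
      + rayleighPDF θ x y * y * (1 / outScale θ a)) = c + outScale θ x / outScale θ a := by
    rw [integral_add i1 i2, integral_mul_const, integral_mul_const, integral_rayleighPDF,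
      integral_rayleighPDF_mul_self]
    ring
  rw [← e]
  refine setIntegral_mono_on (integrableOn_crossEnt x) (i1.add i2) measurableSet_Ici fun y hy => ?_
  have := mul_le_mul_of_nonneg_left (neg_log_outPDF_le (θ := θ) hab hy) (rayleighPDF_pos θ x y).le
  refine this.trans (le_of_eq ?_)
  ring

/-- An unbounded support places mass beyond any a, so both cross entropies have slope at most 1/a in
x up to a constant. For large a the penalty -lx then sends the Lagrangian density to -∞ along the
support, where it should equal C. -/
theorem exists_support_subset_Icc {θ l C : ℝ} (hl : 0 < l) {μ : Measure ℝ≥0}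
    [IsProbabilityMeasure μ] (h : ∀ x ∈ μ.support, lagrangian θ l μ x = C) :
    ∃ B : ℝ≥0, μ.support ⊆ Icc 0 B := by
  -- Chosen so that the combined slope (1 + l)/a of the cross entropies is half the penalty slope l.
  set a : ℝ≥0 := ⟨2 * (1 + l) / l, by positivity⟩ with ha
  have ha0 : 0 < (a : ℝ) := by
    change 0 < 2 * (1 + l) / l
    positivity
  have hal : (1 + l) / (a : ℝ) = l / 2 := by
    change (1 + l) / (2 * (1 + l) / l) = l / 2
    field_simp
  by_contra! hB
  have hex : ∀ r : ℝ≥0, ∃ x ∈ μ.support, r < x := by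
    intro r
    obtain ⟨x, hx, hxr⟩ := not_subset.1 (hB r)
    exact ⟨x, hx, by by_contra! h'; exact hxr ⟨bot_le, h'⟩⟩
  obtain ⟨M, hM, haM⟩ := hex a
  have hpos : 0 < μ.real (Icc a (M + 1)) := by
    have : 0 < μ (Icc a (M + 1)) := by
      refine (Measure.mem_support_iff_forall M).1 hM _ (Icc_mem_nhds haM ?_)
      exact lt_add_of_pos_right M one_pos
    exact ENNReal.toReal_pos this.ne' (measure_ne_top _ _)
  set c₁ := -Real.log (μ.real (Icc a (M + 1)) / outScale θ (M + 1)) with hc1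
  set c₂ := -Real.log (μ.real (Icc a (M + 1)) / outScale 1 (M + 1)) with hc2
  obtain ⟨x, hx, hxr⟩ := hex (Real.toNNReal ((c₁ + 1 + l * (c₂ + 1) - C) * (2 / l)))
  have hx1 := (Real.le_coe_toNNReal _).trans_lt (NNReal.coe_lt_coe.2 hxr)
  have hx0 : 0 ≤ (x : ℝ) := x.2
  have hratio : ∀ η : ℝ, outScale η x / outScale η a ≤ 1 + x / (a : ℝ) := by
    intro η
    rw [div_le_iff₀ (outScale_pos η a)]
    have e1 : (x : ℝ) / a * (η ^ 2 * a + 1) = η ^ 2 * x + x / a := by field_simp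
    have e2 : 0 ≤ (x : ℝ) / a := by positivity
    have e3 : 0 ≤ η ^ 2 * (a : ℝ) := by positivity
    unfold outScale
    nlinarith
  have b1 := crossEnt_le (θ := θ) hpos x
  have b2 := crossEnt_le (θ := 1) hpos x
  have b3 := hratio θ
  have b4 := hratio 1
  have b5 := Real.log_nonneg (one_le_outScale θ x)
  have b6 : outScale 1 x = x + 1 := by simp [outScale]
  have e := h x hx
  rw [lagrangian] at e
  have b7 : l * crossEnt 1 μ x ≤ l * (c₂ + (1 + x / (a : ℝ))) :=
    mul_le_mul_of_nonneg_left (by linarith) hl.le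
  have b8 : (x : ℝ) / a + l * (x / a) = l / 2 * x := by
    rw [← hal]; ring
  have b9 : c₁ + 1 + l * (c₂ + 1) - C < l / 2 * x := by
    have := mul_lt_mul_of_pos_left hx1 (half_pos hl)
    have e3 : l / 2 * ((c₁ + 1 + l * (c₂ + 1) - C) * (2 / l)) = c₁ + 1 + l * (c₂ + 1) - C := by
      field_simp
    linarith
  rw [b6] at e
  nlinarith

/-! ### Excluding infinite supports -/

/-- If the output law of the warden is exponential, the input law is a point mass. -/
theorem ae_eq_of_outPDF_eq_exp {μ : Measure ℝ≥0} [IsProbabilityMeasure μ] {α κ : ℝ}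
    (h : ∀ n : ℕ, outPDF 1 μ n = Real.exp (α + κ * n)) : ∃ c, ∀ᵐ x ∂μ, x = c := by
  set k := Real.exp κ with hk
  have hint : ∀ n : ℕ, Integrable (fun x => rayleighPDF 1 x n) μ := fun n =>
    integrable_rayleighPDF_left n.cast_nonneg
  have hpow : ∀ (n : ℕ) (x : ℝ≥0), rayleighPDF 1 x n =
      1 / outScale 1 x * Real.exp (-(1 / outScale 1 x)) ^ n := by
    intro n x
    rw [rayleighPDF_eq, ← Real.exp_nat_mul]
    congr 2
    ring
  have hval : ∀ n : ℕ, ∫ x, rayleighPDF 1 x n ∂μ = Real.exp α * k ^ n := by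
    intro n
    rw [hk, ← Real.exp_nat_mul, ← Real.exp_add, mul_comm (n : ℝ) κ]
    exact h n
  -- The values at 1, 2, 3 combine into a weighted square of exp(-1/s) - k; for an exponential
  -- output law its mean vanishes, so exp(-1/s) is almost surely constant.
  have hsq : ∀ x, rayleighPDF 1 x (3 : ℕ) + k ^ 2 * rayleighPDF 1 x (1 : ℕ)
      - 2 * k * rayleighPDF 1 x (2 : ℕ) =
      rayleighPDF 1 x (1 : ℕ) * (Real.exp (-(1 / outScale 1 x)) - k) ^ 2 := by
    intro x
    simp only [hpow]
    ring
  obtain ⟨i, e⟩ := integral_add_sub' (hint 3) ((hint 1).const_mul (k ^ 2))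
    ((hint 2).const_mul (2 * k))
  rw [integral_const_mul, integral_const_mul, hval, hval, hval] at e
  have e0 : Real.exp α * k ^ 3 + k ^ 2 * (Real.exp α * k ^ 1) - 2 * k * (Real.exp α * k ^ 2) = 0 := by
    ring
  rw [e0] at e
  simp only [hsq] at i e
  have hae := (integral_eq_zero_iff_of_nonneg
    (fun x => mul_nonneg (rayleighPDF_pos 1 x _).le (sq_nonneg _)) i).1 e
  have hae' : ∀ᵐ x ∂μ, Real.exp (-(1 / outScale 1 x)) = k := by
    filter_upwards [hae] with x hx
    rcases mul_eq_zero.1 hx with h0 | h0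
    · exact absurd h0 (rayleighPDF_pos 1 x _).ne'
    · exact sub_eq_zero.1 (pow_eq_zero_iff two_ne_zero |>.1 h0)
  obtain ⟨c, hc⟩ := hae'.exists
  refine ⟨c, ?_⟩
  filter_upwards [hae'] with x hx
  have h1 := neg_injective (Real.exp_injective (hx.trans hc.symm))
  rw [one_div, one_div, inv_inj] at h1
  unfold outScale at h1
  have h2 : (x : ℝ) = c := by linarith
  exact_mod_cast h2

theorem support_subset_singleton {μ : Measure ℝ≥0} {c : ℝ≥0} (h : ∀ᵐ x ∂μ, x = c) :
    μ.support ⊆ {c} :=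
  Measure.support_subset_of_isClosed isClosed_singleton h

/-- The entire extension of the warden's output density. -/
noncomputable def outPDFC (μ : Measure ℝ≥0) (z : ℂ) : ℂ :=
  complexMGF (fun x => 1 / outScale 1 x) (weighted 1 μ) (-z)

section Entire

variable {μ : Measure ℝ≥0} [IsProbabilityMeasure μ]

omit [IsProbabilityMeasure μ] in
theorem outPDFC_ofReal (y : ℝ) : outPDFC μ y = outPDF 1 μ y := by
  rw [outPDFC, ← Complex.ofReal_neg, complexMGF_ofReal, mgf, outPDF_eq_integral_weighted]
  congr 1
  refine integral_congr_ae (ae_of_all _ fun x => ?_)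
  simp only
  congr 1
  ring

theorem exp_mul_le (τ : ℝ) (x : ℝ≥0) : Real.exp (τ * (1 / outScale 1 x)) ≤ Real.exp |τ| := by
  refine Real.exp_le_exp.2 ?_
  have h1 : 0 ≤ 1 / outScale 1 x := (one_div_pos.2 (outScale_pos 1 x)).le
  calc τ * (1 / outScale 1 x) ≤ |τ| * (1 / outScale 1 x) :=
        mul_le_mul_of_nonneg_right (le_abs_self τ) h1
    _ ≤ |τ| * 1 := mul_le_mul_of_nonneg_left (one_div_outScale_le_one x) (abs_nonneg τ)
    _ = |τ| := mul_one _

theorem integrableExpSet_weighted :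
    integrableExpSet (fun x => 1 / outScale 1 x) (weighted 1 μ) = univ := by
  refine eq_univ_of_forall fun τ => ?_
  refine (integrable_const (Real.exp |τ|)).mono' ?_ (ae_of_all _ fun x => ?_)
  · exact (Real.continuous_exp.comp
      (continuous_const.mul (continuous_one_div_outScale 1))).aestronglyMeasurable
  · rw [Real.norm_of_nonneg (Real.exp_pos _).le]
    exact exp_mul_le τ x

theorem differentiable_outPDFC : Differentiable ℂ (outPDFC μ) := by
  intro z
  have h : AnalyticAt ℂ (complexMGF (fun x => 1 / outScale 1 x) (weighted 1 μ)) (-z) := by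
    apply analyticAt_complexMGF
    rw [integrableExpSet_weighted, interior_univ]
    trivial
  exact (AnalyticAt.fun_comp (f := fun z : ℂ => -z) h analyticAt_id.neg).differentiableAt

/-- The frequencies 1/s and the weights 1/s are all at most 1, so the density extends with
exponential type at most 1. -/
theorem norm_outPDFC_le (z : ℂ) : ‖outPDFC μ z‖ ≤ Real.exp ‖z‖ := by
  refine norm_complexMGF_le_mgf.trans ?_
  rw [mgf, integral_weighted]
  calc ∫ x, 1 / outScale 1 x * Real.exp ((-z).re * (1 / outScale 1 x)) ∂μ
      ≤ ∫ _, Real.exp ‖z‖ ∂μ := by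
        refine integral_mono_of_nonneg (ae_of_all _ fun x => ?_) (integrable_const _)
          (ae_of_all _ fun x => ?_)
        · have := outScale_pos 1 x
          simp only [Pi.zero_apply]
          positivity
        · have h1 : Real.exp ((-z).re * (1 / outScale 1 x)) ≤ Real.exp ‖z‖ := by
            refine (exp_mul_le _ x).trans (Real.exp_le_exp.2 ?_)
            rw [← norm_neg]
            exact Complex.abs_re_le_norm _
          calc _ ≤ 1 * Real.exp ((-z).re * (1 / outScale 1 x)) :=
                mul_le_mul_of_nonneg_right (one_div_outScale_le_one x) (Real.exp_pos _).le
            _ ≤ _ := by rw [one_mul]; exact h1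
    _ = Real.exp ‖z‖ := by simp

/-- If the logarithm of the warden's output density is a Borel transform, it is affine. -/
theorem outPDF_eq_exp_of_eq_borel {b : ℕ → ℝ} {K R : ℝ} (hb : ∀ n, |b n| ≤ K / R ^ n)
    (h : ∀ z : ℝ, 0 ≤ z → -Real.log (outPDF 1 μ z) = (borel b z).re) :
    ∃ α κ : ℝ, ∀ z : ℝ, 0 ≤ z → outPDF 1 μ z = Real.exp (α + κ * z) := by
  have hE := differentiable_borel hb
  have hreal : ∀ y : ℝ, 0 ≤ y → outPDFC μ y = Complex.exp (-borel b y) := by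
    intro y hy
    have h1 : borel b (y : ℂ) = ((-Real.log (outPDF 1 μ y) : ℝ) : ℂ) :=
      Complex.ext (h y hy).symm (by rw [borel_ofReal_im, Complex.ofReal_im])
    rw [h1, outPDFC_ofReal, Complex.ofReal_neg, neg_neg, ← Complex.ofReal_exp,
      Real.exp_log (outPDF_pos hy)]
  have hfreq : ∃ᶠ z in 𝓝[≠] ((1 : ℝ) : ℂ), outPDFC μ z = Complex.exp (-borel b z) := by
    have htend : Tendsto (fun x : ℝ => (x : ℂ)) (𝓝[≠] 1) (𝓝[≠] ((1 : ℝ) : ℂ)) := by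
      refine tendsto_nhdsWithin_of_tendsto_nhds_of_eventually_within _ ?_ ?_
      · exact (Complex.continuous_ofReal.tendsto 1).mono_left nhdsWithin_le_nhds
      · filter_upwards [self_mem_nhdsWithin] with x hx
        intro e
        exact hx (Complex.ofReal_injective e)
    refine htend.frequently (Eventually.frequently ?_)
    filter_upwards [nhdsWithin_le_nhds (Ici_mem_nhds (zero_lt_one (α := ℝ)))] with x hx
      using hreal x hx
  have hexp : Differentiable ℂ fun z => Complex.exp (-borel b z) := hE.neg.cexp
  have hid : ∀ z, outPDFC μ z = Complex.exp (-borel b z) := fun z =>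
    congrFun (AnalyticOnNhd.eq_of_frequently_eq
      (fun z _ => differentiable_outPDFC.analyticAt z) (fun z _ => hexp.analyticAt z) hfreq) z
  -- The modulus of the exponential is the exponential of the real part, so the type bound on the
  -- density is a linear bound on the real part of its logarithm.
  obtain ⟨a, k, hak⟩ := affine_of_re_le (g := fun z => -borel b z) hE.neg fun z => by
    have := norm_outPDFC_le (μ := μ) z
    rwa [hid, Complex.norm_exp, Real.exp_le_exp] at this
  refine ⟨a.re, k.re, fun z hz => ?_⟩
  have h1 := congrArg Complex.re (hak z)
  rw [Complex.neg_re, ← h z hz, neg_neg, Complex.add_re, Complex.re_mul_ofReal] at h1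
  rw [← h1, Real.exp_log (outPDF_pos hz)]

end Entire

/-- Only real t is needed, so the real parts of the Taylor coefficients suffice; the bound K / R^n
is Cauchy's, in the form `borel` requires. -/
theorem exists_real_powerSeries {H : ℂ → ℂ} {R : ℝ≥0} (hR : 0 < R)
    (hH : DifferentiableOn ℂ H (Metric.closedBall 0 R)) :
    ∃ (b : ℕ → ℝ) (K : ℝ), (∀ n, |b n| ≤ K / (R : ℝ) ^ n) ∧
      ∀ t : ℝ, 0 < t → t < R → HasSum (fun n => b n * t ^ n) (H t).re := by
  have hps := hH.hasFPowerSeriesOnBall hR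
  set p := cauchyPowerSeries H 0 R with hp
  refine ⟨fun n => (p.coeff n).re, (2 * Real.pi)⁻¹ * ∫ φ in (0 : ℝ)..2 * Real.pi,
    ‖H (circleMap 0 R φ)‖, fun n => ?_, fun t ht htR => ?_⟩
  · refine (Complex.abs_re_le_norm _).trans ?_
    rw [← FormalMultilinearSeries.norm_apply_eq_norm_coef]
    refine (norm_cauchyPowerSeries_le H 0 R n).trans (le_of_eq ?_)
    rw [NNReal.abs_eq, inv_pow, div_eq_mul_inv]
  · have hmem : (t : ℂ) ∈ Metric.eball (0 : ℂ) R := by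
      rw [Metric.mem_eball, edist_zero_right, ← ofReal_norm, Complex.norm_real,
        Real.norm_of_nonneg ht.le, ← ENNReal.ofReal_coe_nnreal]
      exact (ENNReal.ofReal_lt_ofReal_iff hR).2 htR
    have h := Complex.hasSum_re (hps.hasSum hmem)
    rw [zero_add] at h
    convert! h using 1
    funext n
    rw [FormalMultilinearSeries.apply_eq_pow_smul_coeff, smul_eq_mul, ← Complex.ofReal_pow,
      Complex.re_ofReal_mul, mul_comm]

/-- For `θ ≥ 1` the optimality condition cannot hold on the whole domain of holomorphy. -/
theorem not_lagrangian_identity_of_one_le {θ l C : ℝ} (hl : 0 < l) (hθ : 1 ≤ θ ^ 2)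
    {μ : Measure ℝ≥0} [IsProbabilityMeasure μ]
    (h : ∀ t : ℝ, 0 < t → 0 < θ ^ 2 * (t - 1) + 1 →
      crossEntR θ μ (θ ^ 2 * (t - 1) + 1) - 1 - Real.log (θ ^ 2 * (t - 1) + 1)
        - l * (t - crossEntR 1 μ t) = C) : False := by
  -- Small enough that -log s outweighs 1, lt ≤ l and C together.
  set s := Real.exp (-(l + 2 + |C|)) with hs
  have hs0 : 0 < s := Real.exp_pos _
  have hs1 : s < 1 := by
    rw [hs, Real.exp_lt_one_iff]
    have := abs_nonneg C
    linarith
  have hθ0 : 0 < θ ^ 2 := by linarith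
  -- The point where the main channel's mean is s; θ² ≥ 1 guarantees t ≥ s > 0.
  set t := 1 - (1 - s) / θ ^ 2 with ht
  have h1 : (1 - s) / θ ^ 2 ≤ 1 - s := div_le_self (by linarith) hθ
  have h1' : 0 ≤ (1 - s) / θ ^ 2 := div_nonneg (by linarith) hθ0.le
  have ht0 : 0 < t := by linarith
  have hts : θ ^ 2 * (t - 1) + 1 = s := by
    have : θ ^ 2 * ((1 - s) / θ ^ 2) = 1 - s := mul_div_cancel₀ _ hθ0.ne'
    rw [ht]
    linear_combination -this
  have h2 := h t ht0 (by rw [hts]; exact hs0)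
  rw [hts, hs, Real.log_exp, ← hs] at h2
  have h3 := crossEntR_nonneg (θ := θ) (μ := μ) hs0
  have h4 := mul_nonneg hl.le (crossEntR_nonneg (θ := 1) (μ := μ) ht0)
  have h5 : l * t ≤ l * 1 := mul_le_mul_of_nonneg_left (by linarith) hl.le
  have h6 := le_abs_self C
  nlinarith

/-- For `θ < 1` the optimality condition on the whole domain of holomorphy forces a point mass. -/
theorem ae_eq_of_lagrangian_identity {θ l C : ℝ} (hl : 0 < l) (hθ : θ ^ 2 < 1)
    {μ : Measure ℝ≥0} [IsProbabilityMeasure μ]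
    (h : ∀ t : ℝ, 0 < t → 0 < θ ^ 2 * (t - 1) + 1 →
      crossEntR θ μ (θ ^ 2 * (t - 1) + 1) - 1 - Real.log (θ ^ 2 * (t - 1) + 1)
        - l * (t - crossEntR 1 μ t) = C) : ∃ c, ∀ᵐ x ∂μ, x = c := by
  -- On this disc Re(θ²(w - 1) + 1) ≥ (1 - θ²)(1 - θ²/2) > 0.
  set R : ℝ≥0 := ⟨(1 - θ ^ 2) / 2, by linarith⟩ with hR
  have hRv : (R : ℝ) = (1 - θ ^ 2) / 2 := rfl
  have hR0 : 0 < R := by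
    rw [← NNReal.coe_pos, hRv]; linarith
  -- The identity solved for the warden's cross entropy. Unlike that cross entropy's integral, this
  -- expression makes sense and is holomorphic around t = 0.
  let H : ℂ → ℂ := fun w => (C + 1 + Complex.log ((θ : ℂ) ^ 2 * (w - 1) + 1)
    - crossEntC θ μ ((θ : ℂ) ^ 2 * (w - 1) + 1) + l * w) / l
  have hre : ∀ w : ℂ, ((θ : ℂ) ^ 2 * (w - 1) + 1).re = θ ^ 2 * (w.re - 1) + 1 := by
    intro w
    have : ((θ : ℂ) ^ 2 * (w - 1) + 1) = ((θ ^ 2 : ℝ) : ℂ) * (w - 1) + 1 := by push_cast; rfl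
    rw [this, Complex.add_re, Complex.re_ofReal_mul, Complex.one_re, Complex.sub_re,
      Complex.one_re]
  have hdiff : DifferentiableOn ℂ H (Metric.closedBall 0 R) := by
    intro w hw
    have hw1 : |w.re| ≤ (1 - θ ^ 2) / 2 :=
      (Complex.abs_re_le_norm w).trans (mem_closedBall_zero_iff.1 hw)
    have hpos : 0 < ((θ : ℂ) ^ 2 * (w - 1) + 1).re := by
      rw [hre]
      have := (abs_le.1 hw1).1
      nlinarith [sq_nonneg θ]
    have a1 : DifferentiableAt ℂ (fun w : ℂ => (θ : ℂ) ^ 2 * (w - 1) + 1) w := by fun_prop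
    have a2 : DifferentiableAt ℂ (fun w : ℂ => crossEntC θ μ ((θ : ℂ) ^ 2 * (w - 1) + 1)) w :=
      DifferentiableAt.fun_comp' w (analyticAt_crossEntC hpos).differentiableAt a1
    have a3 : DifferentiableAt ℂ (fun w : ℂ => Complex.log ((θ : ℂ) ^ 2 * (w - 1) + 1)) w :=
      a1.clog (Or.inl hpos)
    exact ((((a3.const_add _).sub a2).add (by fun_prop)).div_const _).differentiableWithinAt
  obtain ⟨b, K, hb, hsum⟩ := exists_real_powerSeries hR0 hdiff
  obtain ⟨c, -, hc⟩ := abs_neg_log_outPDF_le (θ := 1) (μ := μ)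
  have hcont : ContinuousOn (fun y => -Real.log (outPDF 1 μ y)) (Ici 0) :=
    (continuousOn_outPDF.log fun y hy => (outPDF_pos hy).ne').neg
  have hlap : ∀ t : ℝ, 0 < t → t < R → HasSum (fun n => b n * t ^ n)
      (∫ y in Ici (0 : ℝ), 1 / t * Real.exp (-(y / t)) * -Real.log (outPDF 1 μ y)) := by
    intro t ht htR
    have hs : 0 < θ ^ 2 * (t - 1) + 1 := by nlinarith [sq_nonneg θ]
    convert! hsum t ht htR using 1
    have e1 : (θ : ℂ) ^ 2 * ((t : ℂ) - 1) + 1 = ((θ ^ 2 * (t - 1) + 1 : ℝ) : ℂ) := by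
      push_cast; rfl
    have e2 : H t = (((C + 1 + Real.log (θ ^ 2 * (t - 1) + 1)
        - crossEntR θ μ (θ ^ 2 * (t - 1) + 1) + l * t) / l : ℝ) : ℂ) := by
      simp only [H, e1, crossEntC_ofReal, ← Complex.ofReal_log hs.le]
      push_cast
      rfl
    rw [e2, Complex.ofReal_re, eq_div_iff hl.ne']
    have := h t ht hs
    change crossEntR 1 μ t * l = _
    linarith
  obtain ⟨α, κ, hακ⟩ := outPDF_eq_exp_of_eq_borel hb fun z hz =>
    eq_borel_of_hasSum_laplace (NNReal.coe_pos.2 hR0) hb measurable_neg_log_outPDF hcont hc hlap hz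
  exact ae_eq_of_outPDF_eq_exp fun n => hακ n n.cast_nonneg

/-- Inputs maximising a Lagrangian with positive multiplier have finite support. -/
theorem support_finite_of_lagrangian_max {θ l : ℝ} (hl : 0 < l) {μ : Measure ℝ≥0}
    [IsProbabilityMeasure μ] (hf : FiniteMean μ)
    (hopt : ∀ μ' : Measure ℝ≥0, IsProbabilityMeasure μ' → FiniteMean μ' →
      rate θ μ' - l * cost μ' ≤ rate θ μ - l * cost μ) : μ.support.Finite := by
  by_contra hinf
  have hC : ∀ x ∈ μ.support, lagrangian θ l μ x = rate θ μ - l * cost μ := fun x hx =>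
    lagrangian_eq_of_mem_support (lagrangian_ae_eq hl hf hopt) hx
  obtain ⟨B, hB⟩ := exists_support_subset_Icc hl hC
  have hid : ∀ t : ℝ, 0 < t → 0 < θ ^ 2 * (t - 1) + 1 →
      crossEntR θ μ (θ ^ 2 * (t - 1) + 1) - 1 - Real.log (θ ^ 2 * (t - 1) + 1)
        - l * (t - crossEntR 1 μ t) = rate θ μ - l * cost μ := fun t ht hs =>
    lagrangian_identity hC hinf hB ht hs
  rcases le_or_gt 1 (θ ^ 2) with hθ | hθ
  · exact not_lagrangian_identity_of_one_le hl hθ hid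
  · obtain ⟨c, hc⟩ := ae_eq_of_lagrangian_identity hl hθ hid
    exact hinf ((finite_singleton c).subset (support_subset_singleton hc))

/-! ### Small ν: the covertness constraint limits the rate -/

/-- Point masses have nonnegative rate, so nonpositive rate of the fair mixture of 0 and 1 would be
equality in the concavity of the entropy and force the two point masses to coincide. -/
theorem exists_rate_pos {θ : ℝ} (hθ : θ ≠ 0) :
    ∃ μ : Measure ℝ≥0, IsProbabilityMeasure μ ∧ FiniteMean μ ∧ 0 < rate θ μ := by
  have h0 : (0 : ℝ) ≤ 1 / 2 := by norm_num
  have h1 : (1 / 2 : ℝ) ≤ 1 := by norm_num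
  have f0 := finiteMean_dirac 0
  have f1 := finiteMean_dirac 1
  refine ⟨mix (1 / 2) (Measure.dirac 0) (Measure.dirac 1), isProbabilityMeasure_mix h0 h1,
    f0.mix f1, ?_⟩
  by_contra! hle
  have r0 := rate_nonneg (θ := θ) f0
  have r1 := rate_nonneg (θ := θ) f1
  have heq : (Measure.dirac 0 : Measure ℝ≥0) = Measure.dirac 1 := by
    refine eq_of_outEntropy_mix_le hθ f0 f1 ?_
    rw [rate] at hle r0 r1
    rw [integral_mix h0 h1 (integrable_log_outScale f0) (integrable_log_outScale f1)] at hle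
    linarith
  have := congrArg (fun m : Measure ℝ≥0 => m {0}) heq
  simp at this

/-- The rate is at most θ²(ν/δ + 2δ): δ is fixed first to make the second term at most r/4, then ν₀
makes the first less than r/4. -/
theorem exists_rate_bound {θ : ℝ} (hθ : 0 < θ) {r : ℝ} (hr : 0 < r) :
    ∃ ν₀ : ℝ, 0 < ν₀ ∧ ∀ ν : ℝ, 0 < ν → ν < ν₀ → ∀ P ∈ covertInputs ν,
      rate θ (P : Measure ℝ≥0) < r := by
  have hθ2 : 0 < θ ^ 2 := by positivity
  set δ := min (1 / 2) (r / (8 * θ ^ 2)) with hδ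
  have hδ0 : 0 < δ := lt_min (by norm_num) (by positivity)
  have hδ1 : δ ≤ 1 / 2 := min_le_left _ _
  have hδ2 : δ * (8 * θ ^ 2) ≤ r := by
    rw [← le_div_iff₀ (by positivity)]; exact min_le_right _ _
  refine ⟨δ * r / (4 * θ ^ 2), by positivity, fun ν hν hνν P hP => ?_⟩
  obtain ⟨hf, hm⟩ := mean_bound_of_mem_covertInputs hν.le hδ0 (by linarith) hP
  have h1 : ν / δ < r / (4 * θ ^ 2) := by
    rw [div_lt_iff₀ hδ0]
    calc ν < δ * r / (4 * θ ^ 2) := hνν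
      _ = _ := by ring
  have h2 : δ / (1 - δ) ≤ 2 * δ := by
    rw [div_le_iff₀ (by linarith)]; nlinarith
  have h3 : θ ^ 2 * (r / (4 * θ ^ 2)) = r / 4 := by field_simp
  calc rate θ (P : Measure ℝ≥0) ≤ θ ^ 2 * ∫ x, (x : ℝ) ∂(P : Measure ℝ≥0) := rate_le_mul_mean hf
    _ ≤ θ ^ 2 * (r / (4 * θ ^ 2) + 2 * δ) := mul_le_mul_of_nonneg_left (by linarith) hθ2.le
    _ < r := by rw [mul_add, h3]; linarith

end RayleighCovert

open RayleighCovert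

/-! ### Assembly of existence, uniqueness and finiteness -/

theorem mainTheorem5 (θm : ℝ) (hθm : 0 < θm) :
    ∃ ν₀ : ℝ, 0 < ν₀ ∧ ∀ ν : ℝ, 0 < ν → ν < ν₀ →
      ∃ μ : ProbabilityMeasure ℝ≥0,
        IsOptimalInput θm ν μ ∧
        (∀ μ' : ProbabilityMeasure ℝ≥0, IsOptimalInput θm ν μ' → μ' = μ) ∧
        (μ : Measure ℝ≥0).support.Finite := by
  obtain ⟨μ₁, p1, f1, r1⟩ := exists_rate_pos hθm.ne'
  obtain ⟨ν₀, hν₀, hbound⟩ := exists_rate_bound hθm r1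
  refine ⟨ν₀, hν₀, fun ν hν hνν => ?_⟩
  obtain ⟨P, hP, hmax⟩ := exists_rate_max θm hν.le
  have hfin : ∀ Q ∈ covertInputs ν, FiniteMean (Q : Measure ℝ≥0) := fun Q hQ =>
    finiteMean_of_mem_covertInputs hν.le hQ
  have hinfo : ∀ Q ∈ covertInputs ν,
      mutualInfo Q (mainChannel θm) = ENNReal.ofReal (rate θm (Q : Measure ℝ≥0)) := fun Q hQ =>
    mutualInfo_eq_ofReal_rate (hfin Q hQ)
  have hcost : ∀ Q ∈ covertInputs ν, cost (Q : Measure ℝ≥0) ≤ ν := fun Q hQ =>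
    (mem_covertInputs_iff hν.le (hfin Q hQ)).1 hQ
  have hopt : ∀ ρ : Measure ℝ≥0, IsProbabilityMeasure ρ → FiniteMean ρ → cost ρ ≤ ν →
      rate θm ρ ≤ rate θm (P : Measure ℝ≥0) := fun ρ hρ fρ cρ =>
    hmax ⟨ρ, hρ⟩ ((mem_covertInputs_iff (P := ⟨ρ, hρ⟩) hν.le fρ).2 cρ)
  have hvalue : mutualInfo P (mainChannel θm) = covertValue θm ν := by
    refine le_antisymm (le_iSup₂_of_le P hP le_rfl) (iSup₂_le fun Q hQ => ?_)
    rw [hinfo Q hQ, hinfo P hP]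
    exact ENNReal.ofReal_le_ofReal (hmax Q hQ)
  refine ⟨P, ⟨hP, hvalue⟩, fun Q ⟨hQ, hQv⟩ => ?_, ?_⟩
  · rw [← hvalue, hinfo Q hQ, hinfo P hP, ENNReal.ofReal_eq_ofReal_iff (rate_nonneg (hfin Q hQ))
      (rate_nonneg (hfin P hP))] at hQv
    exact Subtype.ext (eq_of_rate_max hθm.ne' (hfin P hP) (hfin Q hQ) (hcost P hP) (hcost Q hQ)
      hopt hQv).symm
  · obtain ⟨l, hl, hlag⟩ := exists_lagrange_multiplier hν (hcost P hP) hopt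
      ⟨μ₁, p1, f1, hbound ν hν hνν P hP⟩
    exact support_finite_of_lagrangian_max hl (hfin P hP) hlag
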